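/- Let $c\in\mathbb C\setminus\{0\}$ and put $$g(x,y)=\frac{c}{x-y},\qquad f(x,y)=1+g(x,y),\qquad h(x,y)=\frac{f(x,y)}{g(x,y)}=\frac{x-y+c}{c},\qquad t(x,y)=\frac{g(x,y)}{h(x,y)} .$$ For finite sets of complex numbers write $f(\bar x,\bar y)=\prod_{x\in\bar x}\prod_{y\in\bar y}f(x,y)$, and similarly for $h$; $\bar x+c$ is the set of all $x+c$ with $x\in\bar x$; $\#\bar x$ is the number of elements of $\bar x$. For $\#\bar x=\#\bar y=k$ let $$\mathsf K_k(\bar x|\bar y)=\prod_{1\le l<m\le k} g(x_l,x_m)\,g(y_m,y_l)\cdot h(\bar x,\bar y)\,\det_k\big[t(x_i,y_j)\big]$$ be the Izergin–Korepin determinant, understood as a rational function (so the singularities at $x_i-y_j=-c$, which are removable, are removed). Let $V$ be a complex vector space and let $T(x)=(T_{ij}(x))_{i,j=1}^3$ be a matrix of operators on $V$, given for $x$ in a set $D\subseteq\mathbb C$, such that $$R_{12}(x,y)T_1(x)T_2(y)=T_2(y)T_1(x)R_{12}(x,y),\qquad R(x,y)=\frac{\mathbf I+g(x,y)\mathbf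 P}{f(x,y)},$$ for all $x\ne y$ in $D$ with $f(x,y)\neq0$, where $\mathbf P$ is the permutation of $\mathbb C^3\otimes\mathbb C^3$. Let $|0\rangle\in V$ be a highest weight vector: $|0\rangle\ne0$, $T_{ij}(x)|0\rangle=0$ for $i>j$, and $T_{ii}(x)|0\rangle=\lambda_i(x)|0\rangle$ for $i=1,2,3$ and $x\in D$. Write $T_{ij}(\bar x)=\prod_{x\in\bar x}T_{ij}(x)$ and $\lambda_2(\bar x)=\prod_{x\in\bar x}\lambda_2(x)$. For finite sets $\bar u,\bar v$ with $\#\bar u=a$, $\#\bar v=b$ the Bethe vector is $$\mathbb B^{a,b}(\bar u;\bar v)=\sum\frac{\mathsf K_k(\bar v_{\rm I}|\bar u_{\rm I})}{\lambda_2(\bar v_{\rm II})\lambda_2(\bar u)}\,\frac{f(\bar v_{\rm II},\bar v_{\rm I})f(\bar u_{\rm II},\bar u_{\rm I})}{f(\bar v_{\rm II},\bar u)f(\bar v_{\rm I},\bar u_{\rm I})}\,T_{12}(\bar u_{\rm II})T_{13}(\bar u_{\rm I})T_{23}(\bar v_{\rm II})|0\rangle ,$$ the sum being over all partitions $\bar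 u=\bar u_{\rm I}\sqcup\bar u_{\rm II}$, $\bar v=\bar v_{\rm I}\sqcup\bar v_{\rm II}$ with $\#\bar u_{\rm I}=\#\bar v_{\rm I}=k$. If $\bar u$ and $\bar v$ have common elements, the coefficients, whose singularities at $v_i=u_j$ are removable, are given their regular values there: $1/f(\bar v_{\rm II},\bar u)=\prod_{v\in\bar v_{\rm II}}\prod_{u\in\bar u}\frac{v-u}{v-u+c}$, and $\mathsf K_k(\bar v_{\rm I}|\bar u_{\rm I})/f(\bar v_{\rm I},\bar u_{\rm I})$ is extended by continuity. Let $\bar u,\bar v,\bar w\subset D$ be pairwise disjoint finite sets with $\#\bar u=a$, $\#\bar v=b$, $\#\bar w=n$ such that $\lambda_2(x)\ne0$ and $x-y\neq c$ for all $x,y\in\bar u\cup\bar v\cup\bar w$. Put $\bar\eta=\bar u\cup\bar w$ and $\bar\xi=\bar v\cup\bar w$. Then $$T_{13}(\bar w)\,\mathbb B^{a,b}(\bar u;\bar v)=\lambda_2(\bar w)\,\mathbb B^{a+n,b+n}(\bar\eta;\bar\xi),$$ $$T_{12}(\bar w)\,\mathbb B^{a,b}(\bar u;\bar v)=(-1)^n\lambda_2(\bar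 w)\sum f(\bar\xi_{\rm II},\bar\xi_{\rm I})\,\mathsf K_n(\bar\xi_{\rm I}|\bar w+c)\,\mathbb B^{a+n,b}(\bar\eta;\bar\xi_{\rm II}),$$ $$T_{23}(\bar w)\,\mathbb B^{a,b}(\bar u;\bar v)=(-1)^n\lambda_2(\bar w)\sum f(\bar\eta_{\rm I},\bar\eta_{\rm II})\,\mathsf K_n(\bar w|\bar\eta_{\rm I}+c)\,\mathbb B^{a,b+n}(\bar\eta_{\rm II};\bar\xi),$$ where the second sum is over all partitions $\bar\xi=\bar\xi_{\rm I}\sqcup\bar\xi_{\rm II}$ with $\#\bar\xi_{\rm I}=n$, and the third is over all partitions $\bar\eta=\bar\eta_{\rm I}\sqcup\bar\eta_{\rm II}$ with $\#\bar\eta_{\rm I}=n$. -/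

import Mathlib

open scoped Kronecker

noncomputable section

namespace GL3

/-- `g(x,y) = c / (x - y)`. -/
def g (c x y : ℂ) : ℂ := c / (x - y)

/-- `f(x,y) = 1 + g(x,y)`. -/
def f (c x y : ℂ) : ℂ := 1 + g c x y

/-- `h(x,y) = f(x,y) / g(x,y) = (x - y + c) / c`. -/
def h (c x y : ℂ) : ℂ := (x - y + c) / c

/-- `t(x,y) = g(x,y) / h(x,y)`. -/
def t (c x y : ℂ) : ℂ := g c x y / h c x y

/-- The function `1 / g(x,y) = (x - y) / c`, including its value `0` at `x = y`. -/
def gInv (c x y : ℂ) : ℂ := (x - y) / c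

/-- The function `1 / f(x,y) = (x - y) / (x - y + c)`, including its value `0` at `x = y`
(where `f` has a pole). -/
def fInv (c x y : ℂ) : ℂ := (x - y) / (x - y + c)

theorem fInv_eq (c x y : ℂ) (hxy : x ≠ y) : fInv c x y = (f c x y)⁻¹ := by
  have : x - y ≠ 0 := sub_ne_zero.mpr hxy
  rw [fInv, f, g, one_add_div this, inv_div]

/-! ### The Izergin-Korepin determinant -/

/-- The prefactor `∏_{l<m} g(x_l,x_m) g(y_m,y_l)`. -/
def ikPre (c : ℂ) {k : ℕ} (x y : Fin k → ℂ) : ℂ :=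
  ∏ l, ∏ m ∈ Finset.Ioi l, g c (x l) (x m) * g c (y m) (y l)

/-- The Izergin-Korepin determinant, literally:
`K_k(x|y) = ∏_{l<m} g(x_l,x_m) g(y_m,y_l) · h(x,y) · det [t(x_i,y_j)]`.
It makes sense when no `x_i - y_j` is `0` or `-c`. -/
def ikLiteral (c : ℂ) {k : ℕ} (x y : Fin k → ℂ) : ℂ :=
  ikPre c x y * (∏ i, ∏ j, h c (x i) (y j)) * (Matrix.of fun i j => t c (x i) (y j)).det

/-- The Izergin-Korepin determinant `K_k(x|y)` as a rational function. Multiplying row `i` of the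
matrix `[t(x_i,y_j)]` by `∏_m h(x_i,y_m)` removes the apparent singularities at `x_i - y_j = -c`;
so this is `ikLiteral` with the removable singularities removed. -/
def ik (c : ℂ) {k : ℕ} (x y : Fin k → ℂ) : ℂ :=
  ikPre c x y *
    (Matrix.of fun i j =>
      g c (x i) (y j) * ∏ m ∈ Finset.univ.erase j, h c (x i) (y m)).det

/-- The rational function `K_k(x|y) / f(x,y)`, where `f(x,y) = ∏_{i,j} f(x_i,y_j)`, with its
removable singularities at `x_i = y_j` removed: the poles of `K` there are cancelled by
the zeros of `1/f`. -/
def ikDivF (c : ℂ) {k : ℕ} (x y : Fin k → ℂ) : ℂ :=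
  ikPre c x y *
    (Matrix.of fun i j =>
      (h c (x i) (y j))⁻¹ * ∏ m ∈ Finset.univ.erase j, gInv c (x i) (y m)).det

/-- `ik` is the literal formula wherever the latter makes sense. -/
theorem ik_eq_ikLiteral (c : ℂ) {k : ℕ} (x y : Fin k → ℂ)
    (hh : ∀ i j, h c (x i) (y j) ≠ 0) : ik c x y = ikLiteral c x y := by
  rw [ik, ikLiteral, mul_assoc]
  congr 1
  rw [← Matrix.det_mul_column]
  congr 1
  ext i j
  simp only [Matrix.of_apply]
  rw [← Finset.mul_prod_erase Finset.univ _ (Finset.mem_univ j), t]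
  have := hh i j
  field_simp

/-- `ik` is continuous wherever the literal formula has at most removable singularities. -/
theorem continuousAt_ik (c : ℂ) {k : ℕ} (x y : Fin k → ℂ) (hx : Function.Injective x)
    (hy : Function.Injective y) (hxy : ∀ i j, x i ≠ y j) :
    ContinuousAt (fun p : (Fin k → ℂ) × (Fin k → ℂ) => ik c p.1 p.2) (x, y) := by
  have hp : ContinuousAt (fun p : (Fin k → ℂ) × (Fin k → ℂ) => ikPre c p.1 p.2) (x, y) := by
    unfold ikPre g
    refine tendsto_finsetProd _ fun l _ => tendsto_finsetProd _ fun m hm => ?_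
    have hlm : l ≠ m := (Finset.mem_Ioi.mp hm).ne
    refine ContinuousAt.mul (ContinuousAt.div (by fun_prop) (by fun_prop) ?_)
      (ContinuousAt.div (by fun_prop) (by fun_prop) ?_)
    · exact sub_ne_zero.mpr fun e => hlm (hx e)
    · exact sub_ne_zero.mpr fun e => hlm (hy e).symm
  unfold ik
  refine hp.mul ?_
  refine (Continuous.matrix_det continuous_id).continuousAt.comp
    (f := fun p : (Fin k → ℂ) × (Fin k → ℂ) => Matrix.of fun i j =>
      g c (p.1 i) (p.2 j) * ∏ m ∈ Finset.univ.erase j, h c (p.1 i) (p.2 m)) ?_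
  refine continuousAt_pi.mpr fun i => continuousAt_pi.mpr fun j => ?_
  simp only [Matrix.of_apply, g, h]
  refine ContinuousAt.mul (ContinuousAt.div (by fun_prop) (by fun_prop) ?_) (by fun_prop)
  exact sub_ne_zero.mpr (hxy i j)

/-- `ikDivF` is `K(x|y) / f(x,y)` wherever the latter makes sense. -/
theorem ikDivF_eq (c : ℂ) (hc : c ≠ 0) {k : ℕ} (x y : Fin k → ℂ) (hxy : ∀ i j, x i ≠ y j)
    (hh : ∀ i j, h c (x i) (y j) ≠ 0) :
    ikDivF c x y = ikLiteral c x y / ∏ i, ∏ j, f c (x i) (y j) := by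
  have hs : ∀ i j, x i - y j ≠ 0 := fun i j => sub_ne_zero.mpr (hxy i j)
  have hs' : ∀ i j, x i - y j + c ≠ 0 := fun i j e => hh i j (by rw [h, e, zero_div])
  rw [← ik_eq_ikLiteral c x y hh, ik, ikDivF, mul_div_assoc]
  congr 1
  rw [div_eq_inv_mul, ← Finset.prod_inv_distrib, ← Matrix.det_mul_column]
  congr 1
  ext i j
  simp only [Matrix.of_apply]
  rw [← Finset.mul_prod_erase Finset.univ _ (Finset.mem_univ j), mul_inv,
    ← Finset.prod_inv_distrib, mul_mul_mul_comm, ← Finset.prod_mul_distrib]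
  congr 1
  · have h1 := hs i j
    have h2 := hs' i j
    rw [f, g, h, one_add_div h1]
    field_simp
  · refine Finset.prod_congr rfl fun m _ => ?_
    have h1 := hs i m
    have h2 := hs' i m
    rw [gInv, f, g, h, one_add_div h1]
    field_simp

/-- `ikDivF` is continuous wherever `K(x|y) / f(x,y)` has at most removable singularities, in
particular at points with `x_i = y_j`. -/
theorem continuousAt_ikDivF (c : ℂ) (hc : c ≠ 0) {k : ℕ} (x y : Fin k → ℂ)
    (hx : Function.Injective x) (hy : Function.Injective y)
    (hh : ∀ i j, h c (x i) (y j) ≠ 0) :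
    ContinuousAt (fun p : (Fin k → ℂ) × (Fin k → ℂ) => ikDivF c p.1 p.2) (x, y) := by
  have hp : ContinuousAt (fun p : (Fin k → ℂ) × (Fin k → ℂ) => ikPre c p.1 p.2) (x, y) := by
    unfold ikPre g
    refine tendsto_finsetProd _ fun l _ => tendsto_finsetProd _ fun m hm => ?_
    have hlm : l ≠ m := (Finset.mem_Ioi.mp hm).ne
    refine ContinuousAt.mul (ContinuousAt.div (by fun_prop) (by fun_prop) ?_)
      (ContinuousAt.div (by fun_prop) (by fun_prop) ?_)
    · exact sub_ne_zero.mpr fun e => hlm (hx e)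
    · exact sub_ne_zero.mpr fun e => hlm (hy e).symm
  unfold ikDivF
  refine hp.mul ?_
  refine (Continuous.matrix_det continuous_id).continuousAt.comp
    (f := fun p : (Fin k → ℂ) × (Fin k → ℂ) => Matrix.of fun i j =>
      (h c (p.1 i) (p.2 j))⁻¹ * ∏ m ∈ Finset.univ.erase j, gInv c (p.1 i) (p.2 m)) ?_
  refine continuousAt_pi.mpr fun i => continuousAt_pi.mpr fun j => ?_
  simp only [Matrix.of_apply, gInv]
  refine ContinuousAt.mul (ContinuousAt.inv₀ (by unfold h; fun_prop) (hh i j)) (by fun_prop)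

/-- The prefactor is antisymmetric in each of the two families. -/
theorem ikPre_perm (c : ℂ) {k : ℕ} (x y : Fin k → ℂ) (σ τ : Equiv.Perm (Fin k)) :
    ikPre c (x ∘ σ) (y ∘ τ) = (σ.sign : ℂ) * (τ.sign : ℂ) * ikPre c x y := by
  have key : ∀ x y : Fin k → ℂ, ikPre c x y =
      (∏ l : Fin k, ∏ m ∈ Finset.Ioi l, (-(c * c))) *
        ((Matrix.vandermonde x).det)⁻¹ * ((Matrix.vandermonde y).det)⁻¹ := by
    intro x y
    rw [Matrix.det_vandermonde, Matrix.det_vandermonde]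
    simp only [ikPre, ← Finset.prod_inv_distrib, ← Finset.prod_mul_distrib]
    refine Finset.prod_congr rfl fun l _ => Finset.prod_congr rfl fun m _ => ?_
    rw [g, g, ← neg_sub (x m) (x l), div_neg, div_eq_mul_inv, div_eq_mul_inv]
    ring
  have hv : ∀ (x : Fin k → ℂ) (σ : Equiv.Perm (Fin k)),
      ((Matrix.vandermonde (x ∘ σ)).det)⁻¹ =
        (σ.sign : ℂ) * ((Matrix.vandermonde x).det)⁻¹ := by
    intro x σ
    have : Matrix.vandermonde (x ∘ σ) = (Matrix.vandermonde x).submatrix σ id := rfl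
    rw [this, Matrix.det_permute, mul_inv]
    congr 1
    rcases Int.units_eq_one_or σ.sign with e | e <;> simp [e]
  rw [key, key, hv, hv]
  ring

/-- `K` is symmetric in each of its two families of variables. -/
theorem ik_perm (c : ℂ) {k : ℕ} (x y : Fin k → ℂ) (σ τ : Equiv.Perm (Fin k)) :
    ik c (x ∘ σ) (y ∘ τ) = ik c x y := by
  have hm : (Matrix.of fun i j => g c ((x ∘ σ) i) ((y ∘ τ) j) *
        ∏ m ∈ Finset.univ.erase j, h c ((x ∘ σ) i) ((y ∘ τ) m)) =
      ((Matrix.of fun i j => g c (x i) (y j) *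
        ∏ m ∈ Finset.univ.erase j, h c (x i) (y m)).submatrix σ id).submatrix id τ := by
    ext i j
    simp only [Matrix.of_apply, Matrix.submatrix_apply, Function.comp, id]
    congr 1
    refine Finset.prod_bij (fun m _ => τ m) ?_ ?_ ?_ ?_
    · intro m hm
      simpa using hm
    · intro m _ m' _ e
      exact τ.injective e
    · intro m hm
      exact ⟨τ.symm m, by simpa [Equiv.symm_apply_eq] using hm, by simp⟩
    · intro m _
      rfl
  rw [ik, ik, hm, ikPre_perm, Matrix.det_permute', Matrix.det_permute]
  rcases Int.units_eq_one_or σ.sign with e | e <;>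
    rcases Int.units_eq_one_or τ.sign with e' | e' <;> simp [e, e']

/-- `K/f` is symmetric in each of its two families of variables. -/
theorem ikDivF_perm (c : ℂ) {k : ℕ} (x y : Fin k → ℂ) (σ τ : Equiv.Perm (Fin k)) :
    ikDivF c (x ∘ σ) (y ∘ τ) = ikDivF c x y := by
  have hm : (Matrix.of fun i j => (h c ((x ∘ σ) i) ((y ∘ τ) j))⁻¹ *
        ∏ m ∈ Finset.univ.erase j, gInv c ((x ∘ σ) i) ((y ∘ τ) m)) =
      ((Matrix.of fun i j => (h c (x i) (y j))⁻¹ *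
        ∏ m ∈ Finset.univ.erase j, gInv c (x i) (y m)).submatrix σ id).submatrix id τ := by
    ext i j
    simp only [Matrix.of_apply, Matrix.submatrix_apply, Function.comp, id]
    congr 1
    refine Finset.prod_bij (fun m _ => τ m) ?_ ?_ ?_ ?_
    · intro m hm
      simpa using hm
    · intro m _ m' _ e
      exact τ.injective e
    · intro m hm
      exact ⟨τ.symm m, by simpa [Equiv.symm_apply_eq] using hm, by simp⟩
    · intro m _
      rfl
  rw [ikDivF, ikDivF, hm, ikPre_perm, Matrix.det_permute', Matrix.det_permute]
  rcases Int.units_eq_one_or σ.sign with e | e <;>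
    rcases Int.units_eq_one_or τ.sign with e' | e' <;> simp [e, e']

/-! ### Functions of finite sets of variables -/

/-- An enumeration of a finite set of `k` complex numbers. The functions below are symmetric in
each set of variables, so that the choice does not matter. -/
def enum (X : Finset ℂ) {k : ℕ} (hk : X.card = k) : Fin k → ℂ :=
  fun i => (X.equivFinOfCardEq hk).symm i

/-- `K_k(X|Y)` for two finite sets with the same number `k` of elements. -/
def K (c : ℂ) (X Y : Finset ℂ) : ℂ :=
  if hXY : Y.card = X.card then ik c (enum X rfl) (enum Y hXY) else 0

/-- `K_k(X|Y) / f(X,Y)` for two finite sets with the same number `k` of elements. -/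
def KDivF (c : ℂ) (X Y : Finset ℂ) : ℂ :=
  if hXY : Y.card = X.card then ikDivF c (enum X rfl) (enum Y hXY) else 0

/-- `f(X,Y) = ∏_{x ∈ X} ∏_{y ∈ Y} f(x,y)`. -/
def fProd (c : ℂ) (X Y : Finset ℂ) : ℂ := ∏ x ∈ X, ∏ y ∈ Y, f c x y

/-- `1 / f(X,Y)`. -/
def fInvProd (c : ℂ) (X Y : Finset ℂ) : ℂ := ∏ x ∈ X, ∏ y ∈ Y, fInv c x y

/-- The shifted set `X + c`. -/
def shift (c : ℂ) (X : Finset ℂ) : Finset ℂ := X.image fun x => x + c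

/-! ### The `R`-matrix, the monodromy matrix and highest weight representations -/

/-- The permutation matrix `P = ∑_{i,j} e_{ij} ⊗ e_{ji}` of `ℂ³ ⊗ ℂ³`. -/
def P : Matrix (Fin 3 × Fin 3) (Fin 3 × Fin 3) ℂ :=
  ∑ i : Fin 3, ∑ j : Fin 3, Matrix.single i j (1 : ℂ) ⊗ₖ Matrix.single j i (1 : ℂ)

/-- The `GL(3)`-invariant `R`-matrix `R(x,y) = (1 + g(x,y) P) / f(x,y)`. -/
def R (c x y : ℂ) : Matrix (Fin 3 × Fin 3) (Fin 3 × Fin 3) ℂ :=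
  (f c x y)⁻¹ • (1 + g c x y • P)

/-- A monodromy matrix of the Yangian of `gl₃` acting on `V`, with spectral parameter in a set
`D` of complex numbers, together with a highest weight vector. The indices `1, 2, 3` of the
entries are the elements `0, 1, 2` of `Fin 3`. -/
structure HighestWeightRep (c : ℂ) (V : Type*) [AddCommGroup V] [Module ℂ V] where
  /-- The set of those spectral parameters at which the monodromy matrix is defined. -/
  D : Set ℂ
  /-- The monodromy matrix `T(x)`, with entries `T_{ij}(x)` in `End V`. -/
  T : ℂ → Matrix (Fin 3) (Fin 3) (Module.End ℂ V)
  /-- `R₁₂(x,y) T₁(x) T₂(y) = T₂(y) T₁(x) R₁₂(x,y)`, whenever `R(x,y)` is defined. -/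
  rtt : ∀ x ∈ D, ∀ y ∈ D, x ≠ y → f c x y ≠ 0 →
    (R c x y).map (algebraMap ℂ (Module.End ℂ V)) *
        ((T x ⊗ₖ (1 : Matrix (Fin 3) (Fin 3) (Module.End ℂ V))) *
          ((1 : Matrix (Fin 3) (Fin 3) (Module.End ℂ V)) ⊗ₖ T y)) =
      (((1 : Matrix (Fin 3) (Fin 3) (Module.End ℂ V)) ⊗ₖ T y) *
          (T x ⊗ₖ (1 : Matrix (Fin 3) (Fin 3) (Module.End ℂ V)))) *
        (R c x y).map (algebraMap ℂ (Module.End ℂ V))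
  /-- The highest weight vector `|0⟩`. -/
  vac : V
  vac_ne_zero : vac ≠ 0
  /-- The weights `λ_i(x)`. -/
  lam : Fin 3 → ℂ → ℂ
  lower_vac : ∀ x ∈ D, ∀ i j : Fin 3, j < i → T x i j vac = 0
  diag_vac : ∀ x ∈ D, ∀ i : Fin 3, T x i i vac = lam i x • vac

namespace HighestWeightRep

variable {c : ℂ} {V : Type*} [AddCommGroup V] [Module ℂ V]

theorem P_apply (i k j l : Fin 3) : P (i, k) (j, l) = if i = l ∧ k = j then 1 else 0 := by
  simp only [P, Matrix.sum_apply, Matrix.kroneckerMap_apply, Matrix.single_apply]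
  fin_cases i <;> fin_cases k <;> fin_cases j <;> fin_cases l <;> simp [Fin.sum_univ_three]

/-- The commutation relations contained in the `RTT` relation:
`[T_{ij}(x), T_{kl}(y)] = g(x,y) (T_{kj}(y) T_{il}(x) - T_{kj}(x) T_{il}(y))`. -/
theorem commutation (M : HighestWeightRep c V) {x y : ℂ} (hx : x ∈ M.D) (hy : y ∈ M.D)
    (hxy : x ≠ y) (hf : f c x y ≠ 0) (i j k l : Fin 3) :
    M.T x i j * M.T y k l - M.T y k l * M.T x i j =
      g c x y • (M.T y k j * M.T x i l - M.T x k j * M.T y i l) := by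
  have hR : (R c x y).map (algebraMap ℂ (Module.End ℂ V)) =
      Matrix.of fun p q : Fin 3 × Fin 3 =>
        (f c x y)⁻¹ • ((if p = q then (1 : Module.End ℂ V) else 0) +
          g c x y • (if p.1 = q.2 ∧ p.2 = q.1 then (1 : Module.End ℂ V) else 0)) := by
    ext p q : 2
    obtain ⟨p1, p2⟩ := p
    obtain ⟨q1, q2⟩ := q
    simp only [R, Matrix.map_apply, Matrix.smul_apply, Matrix.add_apply, Matrix.one_apply,
      Matrix.of_apply, P_apply, Algebra.algebraMap_eq_smul_one]
    split_ifs <;> simp [smul_smul, mul_add, add_smul]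
  have h0 := M.rtt x hx y hy hxy hf
  have hA : (M.T x ⊗ₖ (1 : Matrix (Fin 3) (Fin 3) (Module.End ℂ V))) *
      ((1 : Matrix (Fin 3) (Fin 3) (Module.End ℂ V)) ⊗ₖ M.T y) =
      Matrix.of fun p q : Fin 3 × Fin 3 => M.T x p.1 q.1 * M.T y p.2 q.2 := by
    ext p q : 2
    simp [Matrix.mul_apply, Fintype.sum_prod_type, Matrix.one_apply]
  have hB : ((1 : Matrix (Fin 3) (Fin 3) (Module.End ℂ V)) ⊗ₖ M.T y) *
      (M.T x ⊗ₖ (1 : Matrix (Fin 3) (Fin 3) (Module.End ℂ V))) =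
      Matrix.of fun p q : Fin 3 × Fin 3 => M.T y p.2 q.2 * M.T x p.1 q.1 := by
    ext p q : 2
    simp [Matrix.mul_apply, Fintype.sum_prod_type, Matrix.one_apply]
  rw [hA, hB, hR] at h0
  have h1 := congrFun (congrFun h0 (i, k)) (j, l)
  simp only [Matrix.mul_apply, Matrix.of_apply, Fintype.sum_prod_type,
    smul_mul_assoc, mul_smul_comm, ← Finset.smul_sum, add_mul, mul_add, Finset.sum_add_distrib,
    ite_and, ite_mul, mul_ite, one_mul, mul_one, zero_mul, mul_zero, Finset.sum_ite_eq,
    Finset.sum_ite_eq', Finset.mem_univ, if_true, Finset.sum_ite_irrel, Finset.sum_const_zero]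
    at h1
  have h2 := smul_right_injective (Module.End ℂ V) (inv_ne_zero hf) h1
  rw [smul_sub, sub_eq_sub_iff_add_eq_add, h2, add_comm]

/-- `T_{ij}(X) = ∏_{x ∈ X} T_{ij}(x)`. The factors commute by the `RTT` relation, so that
their order does not matter. -/
def TProd (M : HighestWeightRep c V) (i j : Fin 3) (X : Finset ℂ) : Module.End ℂ V :=
  (X.toList.map fun x => M.T x i j).prod

/-- The factors of `TProd` commute. -/
theorem commute_T (M : HighestWeightRep c V) {x y : ℂ} (hx : x ∈ M.D) (hy : y ∈ M.D)
    (hf : f c x y ≠ 0) (i j : Fin 3) : Commute (M.T x i j) (M.T y i j) := by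
  by_cases hxy : x = y
  · rw [hxy]
  have h1 := M.commutation hx hy hxy hf i j i j
  have h2 : f c x y • (M.T x i j * M.T y i j - M.T y i j * M.T x i j) = 0 := by
    rw [f, add_smul, one_smul, ← neg_sub (M.T y i j * M.T x i j), smul_neg, ← h1]
    rw [neg_sub, h1, ← neg_sub (M.T x i j * M.T y i j), smul_neg, h1]
    abel
  exact sub_eq_zero.mp ((smul_eq_zero.mp h2).resolve_left hf)

/-- `λ₂(X) = ∏_{x ∈ X} λ₂(x)`. -/
def lam2 (M : HighestWeightRep c V) (X : Finset ℂ) : ℂ := ∏ x ∈ X, M.lam 1 x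

/-- The Bethe vector `B^{a,b}(u;v)`, where `a = #u` and `b = #v`:
the sum, over the partitions `u ⇒ {u_I, u_II}` and `v ⇒ {v_I, v_II}` with `#u_I = #v_I`, of
`K(v_I|u_I) / (λ₂(v_II) λ₂(u)) · f(v_II,v_I) f(u_II,u_I) / (f(v_II,u) f(v_I,u_I))
  · T₁₂(u_II) T₁₃(u_I) T₂₃(v_II) |0⟩`.
The coefficients are regular at coinciding elements of `u` and `v`, and stand for their
values there. -/
def betheVector (M : HighestWeightRep c V) (u v : Finset ℂ) : V :=
  ∑ uI ∈ u.powerset, ∑ vI ∈ v.powerset with vI.card = uI.card,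
    (KDivF c vI uI / (M.lam2 (v \ vI) * M.lam2 u) *
        (fProd c (v \ vI) vI * fProd c (u \ uI) uI * fInvProd c (v \ vI) u)) •
      (M.TProd 0 1 (u \ uI) * M.TProd 0 2 uI * M.TProd 1 2 (v \ vI)) M.vac

end HighestWeightRep

end GL3

end

noncomputable section

namespace GL3

/-! Dividing `T(x)` by `λ₂(x)` reduces everything to `λ₂ = 1`. The identity `K_n(x|y+c) = (-1)^n
K_n(y|x)/f(y,x)` (`ik_add`, `K_shift`) then turns every coefficient into a value of the single
function `KDivF`, which is regular where its arguments coincide. In the code the indices 1, 2, 3 are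
0, 1, 2, so that `T02` is `T₁₃`, and `T12Formula` concerns `T₂₃`.

The determinant enters only through recursions that remove one variable. As a function of one column
variable, `K/f` is a sum of simple fractions, which gives `KDivF_insert_right`. A second recursion
with other products (`KDivF_insert_left'`) and the sum rule `KDivF_exchange` follow from it.

With these, moving `T₁₃(w)` through the operators `T₁₂` gives the recursion
`betheVector_insert_left`, which expresses `B(u∪w; v)` through `T₁₂(w) B(u; v)` and the vectors
`T₁₃(w) B(u; v∖x)`. If `w` also belongs to the second set, the zero of `1/f(w,w)` leaves one term,
and this is the action of `T₁₃` (`T02_betheVector`). If it does not, solving the recursion for its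
first term gives the action of `T₁₂` (`T01_betheVector`).

For `T₂₃` one inducts on `u`, together with `T₂₂`, because commuting `T₂₃` with `T₁₂` produces
`T₂₂`. A vector with `z` in both sets is `T₁₃(z)` of a smaller one. A vector with `z` only in the
first set is the one unknown term in the expansion of `T₁₂(z) B(u; v)`. In both cases the RTT
relations reduce the claim to rational identities in at most four variables
(`T12Formula_and_T11Formula`).

Products of operators follow by induction on `w`: the element removed by each new operator joins the
set removed before, and the second recursion for `KDivF` sums over the choice of that element. -/

/-- Moving the weights `b` from rows to columns does not change the determinant: both sides are
`∏ b * det (a / b)`. -/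
theorem det_mul_prod_erase_comm {n R : Type*} [Fintype n] [DecidableEq n] [CommRing R]
    (a b : n → n → R) :
    (Matrix.of fun i j => a i j * ∏ m ∈ Finset.univ.erase j, b i m).det =
      (Matrix.of fun i j => a i j * ∏ m ∈ Finset.univ.erase i, b m j).det := by
  rw [Matrix.det_apply, Matrix.det_apply]
  refine Finset.sum_congr rfl fun σ _ => ?_
  congr 1
  simp only [Matrix.of_apply, Finset.prod_mul_distrib]
  congr 1
  have e1 : ∀ i, ∏ m ∈ Finset.univ.erase i, b (σ i) m = ∏ m, if m = i then 1 else b (σ i) m := by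
    intro i
    rw [← Finset.mul_prod_erase Finset.univ _ (Finset.mem_univ i), if_pos rfl, one_mul]
    exact Finset.prod_congr rfl fun m hm => by rw [if_neg (Finset.ne_of_mem_erase hm)]
  have e2 : ∀ i, ∏ m ∈ Finset.univ.erase (σ i), b m i = ∏ m, if m = i then 1 else b (σ m) i := by
    intro i
    rw [← Equiv.prod_comp σ.symm, ← Finset.mul_prod_erase Finset.univ _ (Finset.mem_univ (σ i)),
      Equiv.symm_apply_apply, if_pos rfl, one_mul]
    refine Finset.prod_congr rfl fun m hm => ?_
    rw [if_neg, Equiv.apply_symm_apply]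
    rw [Equiv.symm_apply_eq]
    exact Finset.ne_of_mem_erase hm
  simp only [e1, e2]
  rw [Finset.prod_comm]
  refine Finset.prod_congr rfl fun i _ => Finset.prod_congr rfl fun m _ => ?_
  simp only [eq_comm]

/-! ### Symmetries and values on finite sets -/

theorem ikPre_swap (c : ℂ) {k : ℕ} (x y : Fin k → ℂ) : ikPre c y x = ikPre c x y := by
  unfold ikPre
  refine Finset.prod_congr rfl fun l _ => Finset.prod_congr rfl fun m _ => ?_
  simp only [g]
  rw [← neg_sub (x l), ← neg_sub (y m), div_neg, div_neg, neg_mul_neg, mul_comm]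

theorem ikPre_neg (c : ℂ) {k : ℕ} (x y : Fin k → ℂ) : ikPre c (-y) (-x) = ikPre c x y := by
  unfold ikPre
  refine Finset.prod_congr rfl fun l _ => Finset.prod_congr rfl fun m _ => ?_
  simp only [g, Pi.neg_apply, neg_sub_neg]
  ring

/-- Everything depends on differences `x_i - y_j` only, so negating and exchanging the two families
changes nothing but the side on which the weights sit. This carries each expansion in one family
over to the other. -/
theorem ikDivF_neg (c : ℂ) {k : ℕ} (x y : Fin k → ℂ) : ikDivF c (-y) (-x) = ikDivF c x y := by
  rw [ikDivF, ikDivF, ikPre_neg, ← Matrix.det_transpose,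
    det_mul_prod_erase_comm (fun i j => (h c (x i) (y j))⁻¹) fun i m => gInv c (x i) (y m)]
  congr 2
  ext i j
  simp only [Matrix.transpose_apply, Matrix.of_apply, h, gInv, Pi.neg_apply, neg_sub_neg]

/-- The shift gives `g(x,y+c) = -1/h(y,x)` and `h(x,y+c) = -1/g(y,x)`, so the matrix entries become
those of `ikDivF`, transposed, up to sign. -/
theorem ik_add (c : ℂ) {k : ℕ} (x y : Fin k → ℂ) :
    ik c x (fun i => y i + c) = (-1) ^ k * ikDivF c y x := by
  have hp : ikPre c x (fun i => y i + c) = ikPre c y x := by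
    rw [ikPre_swap c x y]
    unfold ikPre
    refine Finset.prod_congr rfl fun l _ => Finset.prod_congr rfl fun m _ => ?_
    simp only [g, add_sub_add_right_eq_sub]
  rw [ik, ikDivF, hp, mul_left_comm]
  congr 1
  rw [det_mul_prod_erase_comm (fun i j => (h c (y i) (x j))⁻¹) fun i m => gInv c (y i) (x m),
    ← Matrix.det_transpose]
  -- Each entry carries `(-1)^k`, hence the determinant `(-1)^(k·k) = (-1)^k`; it is written as one
  -- factor `(-1)^k` per row.
  have hsign : ((-1 : ℂ)) ^ k = ∏ _j : Fin k, (-1) ^ k := by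
    rw [Finset.prod_const, Finset.card_univ, Fintype.card_fin]
    rcases Nat.even_or_odd k with e | e <;> simp [e.neg_one_pow]
  rw [hsign, ← Matrix.det_mul_column]
  congr 1
  ext i j
  simp only [Matrix.transpose_apply, Matrix.of_apply]
  have e1 : ∏ m ∈ Finset.univ.erase i, h c (x j) (y m + c) =
      ∏ m ∈ Finset.univ.erase i, ((-1) * gInv c (y m) (x j)) :=
    Finset.prod_congr rfl fun m _ => by rw [h, gInv]; ring
  have e2 : g c (x j) (y i + c) = (-1) * (h c (y i) (x j))⁻¹ := by
    rw [g, h, inv_div, ← neg_sub, ← neg_div_neg_eq, neg_neg]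
    ring
  have e3 : (-1 : ℂ) ^ k = (-1) * (-1) ^ (Finset.univ.erase i).card := by
    rw [← pow_succ', Finset.card_erase_add_one (Finset.mem_univ i), Finset.card_univ,
      Fintype.card_fin]
  rw [e1, e2, Finset.prod_mul_distrib, Finset.prod_const, e3]
  ring

theorem enum_injective (X : Finset ℂ) {k : ℕ} (hk : X.card = k) :
    Function.Injective (enum X hk) :=
  Subtype.val_injective.comp (Equiv.injective _)

theorem image_enum (X : Finset ℂ) {k : ℕ} (hk : X.card = k) :
    Finset.univ.image (enum X hk) = X := by
  ext z
  simp only [Finset.mem_image, Finset.mem_univ, true_and, enum]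
  refine ⟨?_, fun hz => ⟨X.equivFinOfCardEq hk ⟨z, hz⟩, by simp⟩⟩
  rintro ⟨i, rfl⟩
  exact Subtype.coe_prop _

theorem exists_perm_comp_eq {k : ℕ} {x x' : Fin k → ℂ} (hx : Function.Injective x)
    (hx' : Function.Injective x') (e : Finset.univ.image x = Finset.univ.image x') :
    ∃ σ : Equiv.Perm (Fin k), x ∘ σ = x' := by
  have hr : Set.range x = Set.range x' := by
    rw [← Set.image_univ, ← Set.image_univ, ← Finset.coe_univ, ← Finset.coe_image, e,
      Finset.coe_image]
  refine ⟨(Equiv.ofInjective x' hx').trans ((Equiv.setCongr hr.symm).trans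
    (Equiv.ofInjective x hx).symm), ?_⟩
  ext i
  simp [Equiv.apply_ofInjective_symm hx]

/-- By symmetry any enumeration may replace the chosen one, so identities for families indexed by
`Fin k` pass to finite sets. -/
theorem KDivF_eq_ikDivF (c : ℂ) {k : ℕ} {x y : Fin k → ℂ} {X Y : Finset ℂ}
    (hx : Function.Injective x) (hy : Function.Injective y) (hX : Finset.univ.image x = X)
    (hY : Finset.univ.image y = Y) : KDivF c X Y = ikDivF c x y := by
  have hXc : X.card = k := by rw [← hX, Finset.card_image_of_injective _ hx]; simp
  have hYc : Y.card = k := by rw [← hY, Finset.card_image_of_injective _ hy]; simp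
  subst hXc
  rw [KDivF, dif_pos hYc]
  obtain ⟨σ, hσ⟩ := exists_perm_comp_eq hx (enum_injective X rfl) (by rw [hX, image_enum])
  obtain ⟨τ, hτ⟩ := exists_perm_comp_eq hy (enum_injective Y hYc) (by rw [hY, image_enum])
  rw [← hσ, ← hτ, ikDivF_perm]

theorem K_eq_ik (c : ℂ) {k : ℕ} {x y : Fin k → ℂ} {X Y : Finset ℂ}
    (hx : Function.Injective x) (hy : Function.Injective y) (hX : Finset.univ.image x = X)
    (hY : Finset.univ.image y = Y) : K c X Y = ik c x y := by
  have hXc : X.card = k := by rw [← hX, Finset.card_image_of_injective _ hx]; simp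
  have hYc : Y.card = k := by rw [← hY, Finset.card_image_of_injective _ hy]; simp
  subst hXc
  rw [K, dif_pos hYc]
  obtain ⟨σ, hσ⟩ := exists_perm_comp_eq hx (enum_injective X rfl) (by rw [hX, image_enum])
  obtain ⟨τ, hτ⟩ := exists_perm_comp_eq hy (enum_injective Y hYc) (by rw [hY, image_enum])
  rw [← hσ, ← hτ, ik_perm]

theorem KDivF_of_card_ne (c : ℂ) {X Y : Finset ℂ} (hXY : Y.card ≠ X.card) : KDivF c X Y = 0 :=
  dif_neg hXY

theorem KDivF_empty (c : ℂ) : KDivF c ∅ ∅ = 1 := by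
  rw [KDivF_eq_ikDivF c (k := 0) (x := Fin.elim0) (y := Fin.elim0)
    (fun i => i.elim0) (fun i => i.elim0) (by simp) (by simp)]
  simp [ikDivF, ikPre]

theorem K_shift (c : ℂ) {X Y : Finset ℂ} (hXY : Y.card = X.card) :
    K c X (shift c Y) = (-1) ^ X.card * KDivF c Y X := by
  rw [K_eq_ik c (enum_injective X rfl)
    (fun i j e => enum_injective Y hXY (add_right_cancel (e : enum Y hXY i + c = _)))
    (image_enum X rfl)
    (show Finset.univ.image (fun i => enum Y hXY i + c) = shift c Y by
      conv_rhs => rw [shift, ← image_enum Y hXY, Finset.image_image]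
      rfl), ik_add,
    KDivF_eq_ikDivF c (enum_injective Y hXY) (enum_injective X rfl) (image_enum _ _)
      (image_enum _ _)]

theorem KDivF_neg (c : ℂ) (X Y : Finset ℂ) :
    KDivF c (Y.image Neg.neg) (X.image Neg.neg) = KDivF c X Y := by
  have hcard : ∀ Z : Finset ℂ, (Z.image Neg.neg).card = Z.card :=
    fun Z => Finset.card_image_of_injective _ neg_injective
  by_cases hXY : Y.card = X.card
  · rw [KDivF_eq_ikDivF c (x := -enum Y hXY) (y := -enum X rfl)
      (neg_injective.comp (enum_injective Y hXY)) (neg_injective.comp (enum_injective X rfl))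
      (by conv_rhs => rw [← image_enum Y hXY, Finset.image_image]
          rfl)
      (by conv_rhs => rw [← image_enum X rfl, Finset.image_image]
          rfl), ikDivF_neg,
      KDivF_eq_ikDivF c (enum_injective X rfl) (enum_injective Y hXY) (image_enum _ _)
      (image_enum _ _)]
  · rw [KDivF_of_card_ne c hXY, KDivF_of_card_ne]
    rwa [hcard, hcard, ne_comm, ne_eq]

/-! ### Recursion for the Izergin-Korepin determinant -/

/-- The product `∏_{l<m} g(x_l,x_m)`. -/
def gOrd (c : ℂ) {k : ℕ} (x : Fin k → ℂ) : ℂ := ∏ l, ∏ m ∈ Finset.Ioi l, g c (x l) (x m)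

/-- The product `∏_{l<m} g(y_m,y_l)`. -/
def gOrdRev (c : ℂ) {k : ℕ} (y : Fin k → ℂ) : ℂ := ∏ l, ∏ m ∈ Finset.Ioi l, g c (y m) (y l)

theorem ikPre_eq_gOrd_mul (c : ℂ) {k : ℕ} (x y : Fin k → ℂ) :
    ikPre c x y = gOrd c x * gOrdRev c y := by
  simp only [ikPre, gOrd, gOrdRev, Finset.prod_mul_distrib]

theorem gOrd_perm (c : ℂ) (hc : c ≠ 0) {k : ℕ} (x : Fin k → ℂ) (σ : Equiv.Perm (Fin k)) :
    gOrd c (x ∘ σ) = (σ.sign : ℂ) * gOrd c x := by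
  -- The dummy second family `0, …, k-1` has distinct members, so its factor is nonzero and cancels.
  have h1 := ikPre_perm c x (fun i : Fin k => ((i : ℕ) : ℂ)) σ 1
  rw [ikPre_eq_gOrd_mul, ikPre_eq_gOrd_mul, Equiv.Perm.coe_one, Function.comp_id] at h1
  have h2 : gOrdRev c (fun i : Fin k => ((i : ℕ) : ℂ)) ≠ 0 := by
    refine Finset.prod_ne_zero_iff.mpr fun l _ => Finset.prod_ne_zero_iff.mpr fun m hm => ?_
    refine div_ne_zero hc (sub_ne_zero.mpr fun e => ?_)
    have := Fin.ext (Nat.cast_injective e)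
    exact (Finset.mem_Ioi.mp hm).ne' this
  refine mul_right_cancel₀ h2 ?_
  rw [h1]
  simp [mul_assoc]

theorem gOrd_cons (c : ℂ) {k : ℕ} (a : ℂ) (x : Fin k → ℂ) :
    gOrd c (Fin.cons a x) = (∏ l, g c a (x l)) * gOrd c x := by
  simp [gOrd, Fin.prod_univ_succ, Fin.prod_Ioi_succ]

theorem gOrdRev_cons (c : ℂ) {k : ℕ} (a : ℂ) (x : Fin k → ℂ) :
    gOrdRev c (Fin.cons a x) = (∏ l, g c (x l) a) * gOrdRev c x := by
  simp [gOrdRev, Fin.prod_univ_succ, Fin.prod_Ioi_succ]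

/-- A cycle of sign `(-1)^i` moves `x_i` to the front. This sign will cancel the sign of the
cofactor in the expansion along the first column. -/
theorem gOrd_succAbove (c : ℂ) (hc : c ≠ 0) {k : ℕ} (x : Fin (k + 1) → ℂ) (i : Fin (k + 1)) :
    gOrd c x = (-1) ^ (i : ℕ) * ((∏ l, g c (x i) (x (i.succAbove l))) *
      gOrd c (x ∘ i.succAbove)) := by
  have h1 := gOrd_perm c hc x i.cycleRange.symm
  rw [← Fin.cons_removeNth_eq_comp_cycleRange_symm, gOrd_cons, Equiv.Perm.sign_symm,
    Fin.sign_cycleRange] at h1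
  have h2 : ((((-1 : ℤˣ) ^ (i : ℕ) : ℤˣ) : ℤ) : ℂ) = (-1) ^ (i : ℕ) := by push_cast; rfl
  rw [h2] at h1
  have h3 : (-1 : ℂ) ^ (i : ℕ) * (-1) ^ (i : ℕ) = 1 := by
    rw [← mul_pow]; simp
  calc gOrd c x = ((-1 : ℂ) ^ (i : ℕ) * (-1) ^ (i : ℕ)) * gOrd c x := by rw [h3, one_mul]
    _ = _ := by rw [mul_assoc, ← h1]; rfl

/-- The matrix whose determinant enters `ikDivF`. -/
def ikMat (c : ℂ) {k : ℕ} (x y : Fin k → ℂ) : Matrix (Fin k) (Fin k) ℂ :=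
  Matrix.of fun i j => (h c (x i) (y j))⁻¹ * ∏ m ∈ Finset.univ.erase j, gInv c (x i) (y m)

theorem prod_erase_zero {k : ℕ} (F : Fin (k + 1) → ℂ) :
    ∏ m ∈ Finset.univ.erase 0, F m = ∏ m : Fin k, F m.succ := by
  have : (Finset.univ.erase (0 : Fin (k + 1))) = Finset.univ.map (Fin.succEmb k) := by
    ext m
    refine Fin.cases ?_ (fun m => ?_) m <;> simp
  rw [this, Finset.prod_map]
  rfl

theorem prod_erase_succ {k : ℕ} (F : Fin (k + 1) → ℂ) (j : Fin k) :
    ∏ m ∈ Finset.univ.erase j.succ, F m = F 0 * ∏ m ∈ Finset.univ.erase j, F m.succ := by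
  have : (Finset.univ.erase j.succ) =
      insert 0 ((Finset.univ.erase j).map (Fin.succEmb k)) := by
    ext m
    refine Fin.cases ?_ (fun m => ?_) m <;> simp [(Fin.succ_ne_zero j).symm]
  rw [this, Finset.prod_insert (by simp), Finset.prod_map]
  rfl

theorem det_ikMat_cons (c : ℂ) {k : ℕ} (x : Fin (k + 1) → ℂ) (y : Fin k → ℂ) (z : ℂ) :
    (ikMat c x (Fin.cons z y)).det = ∑ i : Fin (k + 1), (-1) ^ (i : ℕ) *
      ((h c (x i) z)⁻¹ * ∏ m, gInv c (x i) (y m)) *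
      ((∏ l, gInv c (x (i.succAbove l)) z) * (ikMat c (x ∘ i.succAbove) y).det) := by
  rw [Matrix.det_succ_column_zero]
  refine Finset.sum_congr rfl fun i _ => ?_
  congr 1
  · simp [ikMat, prod_erase_zero]
  · rw [← Matrix.det_mul_column]
    congr 1
    ext l j
    simp [ikMat, prod_erase_succ]
    ring

/-- Two columns coincide. These are the zeros in the new variable that the partial fraction argument
divides out. -/
theorem det_ikMat_cons_eq_zero (c : ℂ) {k : ℕ} (x : Fin (k + 1) → ℂ) (y : Fin k → ℂ)
    (m : Fin k) : (ikMat c x (Fin.cons (y m) y)).det = 0 := by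
  refine Matrix.det_zero_of_column_eq (i := 0) (j := m.succ) (Fin.succ_ne_zero m).symm fun i => ?_
  simp [ikMat, prod_erase_zero, prod_erase_succ]
  left
  rw [Finset.mul_prod_erase Finset.univ (fun m => gInv c (x i) (y m)) (Finset.mem_univ m)]

open Polynomial in
/-- A sum of simple fractions `α_i / h(x_i,z) ∏_{l≠i} 1/g(x_l,z)` which vanishes at all `y_m` is
`∏_m 1/g(y_m,z)` times a sum of simple fractions. -/
theorem sum_eq_prod_mul_sum_of_forall_eq_zero (c : ℂ) {k : ℕ}
    (x : Fin (k + 1) → ℂ) (y : Fin k → ℂ) (hx : Function.Injective x)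
    (hy : Function.Injective y) (hxy : ∀ i j, h c (x i) (y j) ≠ 0) (α : Fin (k + 1) → ℂ)
    (h0 : ∀ m, ∑ i, (h c (x i) (y m))⁻¹ * (α i * ∏ l, gInv c (x (i.succAbove l)) (y m)) = 0)
    (z : ℂ) (hz : ∀ i, h c (x i) z ≠ 0) :
    ∑ i, (h c (x i) z)⁻¹ * (α i * ∏ l, gInv c (x (i.succAbove l)) z) =
      (∏ m, gInv c (y m) z) * ∑ i, (h c (x i) z)⁻¹ *
        (α i * (∏ l, h c (x i) (x (i.succAbove l))) * ∏ m, (h c (x i) (y m))⁻¹) := by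
  -- The values forced by comparing residues at `z = x_i + c`, the zero of `h(x_i, z)`.
  set β : Fin (k + 1) → ℂ := fun i =>
    α i * (∏ l, h c (x i) (x (i.succAbove l))) * ∏ m, (h c (x i) (y m))⁻¹ with hβ
  let G : ℂ → ℂ[X] := fun a => (C a - X) * C c⁻¹
  let H : ℂ → ℂ[X] := fun a => (C (a + c) - X) * C c⁻¹
  have hG : ∀ a t, (G a).eval t = gInv c a t := fun a t => by simp [G, gInv, div_eq_mul_inv]
  have hH : ∀ a t, (H a).eval t = h c a t := fun a t => by
    simp only [H, h, div_eq_mul_inv, eval_mul, eval_sub, eval_C, eval_X]; ring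
  have dG : ∀ a, (G a).natDegree ≤ 1 := fun a => by
    refine natDegree_mul_le.trans ?_
    rw [natDegree_C, add_zero]
    exact (natDegree_sub_le _ _).trans (by simp)
  have dH : ∀ a, (H a).natDegree ≤ 1 := fun a => by
    refine natDegree_mul_le.trans ?_
    rw [natDegree_C, add_zero]
    exact (natDegree_sub_le _ _).trans (by simp)
  have dprod : ∀ F : Fin k → ℂ[X], (∀ m, (F m).natDegree ≤ 1) → (∏ m, F m).natDegree ≤ k := by
    intro F hF
    refine (natDegree_prod_le _ _).trans ((Finset.sum_le_sum fun m _ => hF m).trans ?_)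
    simp
  -- The difference of the two sides, multiplied by `∏ h(x_i, z)`. Its degree is at most `2k` and it
  -- vanishes at the `2k + 1` points `y_m` and `x_i + c`, which are distinct because `h(x_i, y_m) ≠
  -- 0`.
  let p : ℂ[X] := ∑ i, (∏ l, H (x (i.succAbove l))) * (C (α i) * ∏ l, G (x (i.succAbove l))) -
    (∏ m, G (y m)) * ∑ i, (∏ l, H (x (i.succAbove l))) * C (β i)
  have dp : p.natDegree ≤ k + k := by
    refine (natDegree_sub_le _ _).trans (max_le ?_ ?_)
    · refine natDegree_sum_le_of_forall_le _ _ fun i _ => ?_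
      refine natDegree_mul_le.trans (add_le_add (dprod _ fun m => dH _) ?_)
      refine natDegree_mul_le.trans ?_
      rw [natDegree_C, zero_add]
      exact dprod _ fun m => dG _
    · refine natDegree_mul_le.trans (add_le_add (dprod _ fun m => dG _) ?_)
      refine natDegree_sum_le_of_forall_le _ _ fun i _ => ?_
      refine natDegree_mul_le.trans ?_
      rw [natDegree_C, add_zero]
      exact dprod _ fun m => dH _
  have ep : ∀ t, p.eval t =
      ∑ i, (∏ l, h c (x (i.succAbove l)) t) * (α i * ∏ l, gInv c (x (i.succAbove l)) t) -
      (∏ m, gInv c (y m) t) * ∑ i, (∏ l, h c (x (i.succAbove l)) t) * β i := by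
    intro t
    simp only [p, eval_sub, eval_finsetSum, eval_mul, eval_prod, eval_C, hG, hH]
  have split : ∀ t, (∀ i, h c (x i) t ≠ 0) → ∀ i, ∏ l, h c (x (i.succAbove l)) t =
      (∏ i, h c (x i) t) * (h c (x i) t)⁻¹ := by
    intro t ht i
    rw [Fin.prod_univ_succAbove _ i]
    field_simp [ht i]
  have nodeY : ∀ m, p.eval (y m) = 0 := by
    intro m
    rw [ep, Finset.prod_eq_zero (Finset.mem_univ m) (by simp [gInv]), zero_mul, sub_zero]
    simp only [split _ fun i => hxy i m, mul_assoc, ← Finset.mul_sum]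
    rw [h0, mul_zero]
  have nodeX : ∀ i, p.eval (x i + c) = 0 := by
    intro i
    have key : ∀ j ≠ i, ∏ l, h c (x (j.succAbove l)) (x i + c) = 0 := by
      intro j hj
      obtain ⟨l, hl⟩ := Fin.exists_succAbove_eq hj.symm
      exact Finset.prod_eq_zero (Finset.mem_univ l) (by rw [hl, h]; simp)
    rw [ep, Finset.sum_eq_single i, Finset.sum_eq_single i]
    · have hsign : ∀ F F' : Fin k → ℂ, (∀ l, F l = -1 * F' l) →
          ∏ l, F l = (-1) ^ k * ∏ l, F' l := by
        intro F F' e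
        rw [Finset.prod_congr rfl fun l _ => e l, Finset.prod_mul_distrib, Finset.prod_const,
          Finset.card_univ, Fintype.card_fin]
      have e1 : ∏ l, gInv c (x (i.succAbove l)) (x i + c) =
          (-1) ^ k * ∏ l, h c (x i) (x (i.succAbove l)) :=
        hsign _ _ fun l => by rw [gInv, h]; ring
      have e2 : ∏ m, gInv c (y m) (x i + c) = (-1) ^ k * ∏ m, h c (x i) (y m) :=
        hsign _ _ fun l => by rw [gInv, h]; ring
      have e3 : (∏ m, h c (x i) (y m)) * ∏ m, (h c (x i) (y m))⁻¹ = 1 := by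
        rw [← Finset.prod_mul_distrib]
        exact Finset.prod_eq_one fun m _ => mul_inv_cancel₀ (hxy i m)
      rw [e1, e2, hβ]
      linear_combination (-(∏ l, h c (x (i.succAbove l)) (x i + c)) * (-1) ^ k * α i *
        ∏ l, h c (x i) (x (i.succAbove l))) * e3
    · intro j _ hj; rw [key j hj, zero_mul]
    · intro hi; exact absurd (Finset.mem_univ i) hi
    · intro j _ hj; rw [key j hj, zero_mul]
    · intro hi; exact absurd (Finset.mem_univ i) hi
  have p0 : p = 0 := by
    refine eq_zero_of_natDegree_lt_card_of_eval_eq_zero p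
      (f := Sum.elim y fun i => x i + c) ?_ ?_ ?_
    · refine Function.Injective.sumElim hy (fun i j e => hx (add_right_cancel e)) ?_
      intro m i e
      refine hxy i m ?_
      rw [h, e]
      simp
    · rintro (m | i)
      · exact nodeY m
      · exact nodeX i
    · simp
      omega
  have hz' := ep z
  rw [p0, eval_zero, eq_comm, sub_eq_zero] at hz'
  simp only [split z hz, mul_assoc, ← Finset.mul_sum] at hz'
  rw [mul_left_comm] at hz'
  have := mul_left_cancel₀ (Finset.prod_ne_zero_iff.mpr fun i _ => hz i) hz'
  simpa only [mul_assoc, hβ] using this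

theorem gInv_mul_g (c : ℂ) (hc : c ≠ 0) {x y : ℂ} (hxy : x ≠ y) : gInv c x y * g c x y = 1 := by
  rw [gInv, g]
  have := sub_ne_zero.mpr hxy
  field_simp

theorem h_mul_g (c : ℂ) (hc : c ≠ 0) {x y : ℂ} (hxy : x ≠ y) : h c x y * g c x y = f c x y := by
  rw [h, g, f, g]
  have := sub_ne_zero.mpr hxy
  field_simp

theorem h_inv_mul_gInv (c : ℂ) (hc : c ≠ 0) {x y : ℂ} :
    (h c x y)⁻¹ * gInv c x y = fInv c x y := by
  rw [h, gInv, fInv, inv_div, div_mul_div_comm, mul_comm c, mul_div_mul_right _ _ hc]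

/-- The cofactor expansion along the column of `z` is a sum of simple fractions in `z` vanishing at
every `y_m`. Dividing out these zeros cancels the new factors `g(y_m,z)` of the prefactor, and the
remaining products combine by `h g = f`. -/
theorem ikDivF_cons (c : ℂ) (hc : c ≠ 0) {k : ℕ} (x : Fin (k + 1) → ℂ) (y : Fin k → ℂ)
    (z : ℂ) (hx : Function.Injective x) (hy : Function.Injective y)
    (hxy : ∀ i j, h c (x i) (y j) ≠ 0) (hz : ∀ i, h c (x i) z ≠ 0) (hzy : ∀ m, y m ≠ z) :
    ikDivF c x (Fin.cons z y) = ∑ i, (h c (x i) z)⁻¹ *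
      ((∏ l, f c (x i) (x (i.succAbove l))) * (∏ m, fInv c (x i) (y m)) *
        ikDivF c (x ∘ i.succAbove) y) := by
  set α : Fin (k + 1) → ℂ := fun i => (∏ m, gInv c (x i) (y m)) *
    (∏ l, g c (x i) (x (i.succAbove l))) * ikDivF c (x ∘ i.succAbove) y with hα
  have hS : ∀ z, ∑ i, (h c (x i) z)⁻¹ * (α i * ∏ l, gInv c (x (i.succAbove l)) z) =
      gOrd c x * gOrdRev c y * (ikMat c x (Fin.cons z y)).det := by
    intro z
    rw [det_ikMat_cons, Finset.mul_sum]
    refine Finset.sum_congr rfl fun i _ => ?_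
    have h3 : (-1 : ℂ) ^ (i : ℕ) * (-1) ^ (i : ℕ) = 1 := by
      rw [← mul_pow]; simp
    have h4 : ikDivF c (x ∘ i.succAbove) y =
      gOrd c (x ∘ i.succAbove) * gOrdRev c y * (ikMat c (x ∘ i.succAbove) y).det := by
      rw [← ikPre_eq_gOrd_mul]; rfl
    rw [gOrd_succAbove c hc x i, hα]
    simp only [h4]
    linear_combination (-(h c (x i) z)⁻¹ * (∏ m, gInv c (x i) (y m)) *
      (∏ l, g c (x i) (x (i.succAbove l))) * (∏ l, gInv c (x (i.succAbove l)) z) *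
      gOrd c (x ∘ i.succAbove) * gOrdRev c y * (ikMat c (x ∘ i.succAbove) y).det) * h3
  have h1 := sum_eq_prod_mul_sum_of_forall_eq_zero c x y hx hy hxy α
    (fun m => by rw [hS, det_ikMat_cons_eq_zero, mul_zero]) z hz
  rw [hS] at h1
  have h2 : ikDivF c x (Fin.cons z y) =
      (∏ l, g c (y l) z) * (gOrd c x * gOrdRev c y * (ikMat c x (Fin.cons z y)).det) := by
    rw [show ikDivF c x (Fin.cons z y) =
      ikPre c x (Fin.cons z y) * (ikMat c x (Fin.cons z y)).det from rfl, ikPre_eq_gOrd_mul,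
      gOrdRev_cons]
    ring
  have h5 : (∏ l, g c (y l) z) * ∏ m, gInv c (y m) z = 1 := by
    rw [← Finset.prod_mul_distrib]
    exact Finset.prod_eq_one fun m _ => by rw [mul_comm, gInv_mul_g c hc (hzy m)]
  rw [h2, h1, ← mul_assoc, h5, one_mul]
  refine Finset.sum_congr rfl fun i _ => ?_
  congr 1
  have h6 : ∏ l, f c (x i) (x (i.succAbove l)) = (∏ l, h c (x i) (x (i.succAbove l))) *
      ∏ l, g c (x i) (x (i.succAbove l)) := by
    rw [← Finset.prod_mul_distrib]
    exact Finset.prod_congr rfl fun l _ =>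
      (h_mul_g c hc fun e => Fin.succAbove_ne i l (hx e).symm).symm
  have h7 : ∏ m, fInv c (x i) (y m) = (∏ m, (h c (x i) (y m))⁻¹) * ∏ m, gInv c (x i) (y m) := by
    rw [← Finset.prod_mul_distrib]
    exact Finset.prod_congr rfl fun l _ => (h_inv_mul_gInv c hc).symm
  rw [h6, h7, hα]
  ring

/-! ### Recursions and an exchange identity for `KDivF` -/

theorem KDivF_insert_right (c : ℂ) (hc : c ≠ 0) {X Y : Finset ℂ} {z : ℂ} (hz : z ∉ Y)
    (hXz : ∀ x ∈ X, h c x z ≠ 0) (hXY : ∀ x ∈ X, ∀ y ∈ Y, h c x y ≠ 0) :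
    KDivF c X (insert z Y) = ∑ x ∈ X, (h c x z)⁻¹ * ((∏ x' ∈ X.erase x, f c x x') *
      (∏ y ∈ Y, fInv c x y) * KDivF c (X.erase x) Y) := by
  by_cases hcard : X.card = Y.card + 1
  · set x := enum X hcard
    set y := enum Y rfl
    have hx : Function.Injective x := enum_injective _ _
    have hy : Function.Injective y := enum_injective _ _
    have hxX : Finset.univ.image x = X := image_enum _ _
    have hyY : Finset.univ.image y = Y := image_enum _ _
    have mx : ∀ i, x i ∈ X := fun i => by
      rw [← hxX]; exact Finset.mem_image_of_mem _ (Finset.mem_univ i)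
    have my : ∀ i, y i ∈ Y := fun i => by
      rw [← hyY]; exact Finset.mem_image_of_mem _ (Finset.mem_univ i)
    have himg : ∀ i, Finset.univ.image (x ∘ i.succAbove) = X.erase (x i) := by
      intro i
      rw [← hxX, ← Finset.image_image, ← Finset.image_erase hx]
      congr 1
      ext m
      simp only [Finset.mem_image, Finset.mem_univ, true_and, Finset.mem_erase, and_true]
      exact ⟨fun ⟨l, hl⟩ => hl ▸ Fin.succAbove_ne i l, fun hm => Fin.exists_succAbove_eq hm⟩
    have hinj : ∀ i : Fin (Y.card + 1), Function.Injective (x ∘ i.succAbove) :=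
      fun i => hx.comp Fin.succAbove_right_injective
    have hcons : Function.Injective (Fin.cons z y : Fin (Y.card + 1) → ℂ) := by
      rw [Fin.cons_injective_iff]
      refine ⟨?_, hy⟩
      rintro ⟨i, hi⟩
      exact hz (hi ▸ my i)
    rw [KDivF_eq_ikDivF c hx hcons hxX
      (by ext t
          simp [Fin.exists_fin_succ, ← hyY, eq_comm]),
      ikDivF_cons c hc x y z hx hy (fun i j => hXY _ (mx i) _ (my j)) (fun i => hXz _ (mx i))
        (fun m e => hz (e ▸ my m))]
    conv_rhs => rw [← hxX, Finset.sum_image fun i _ j _ e => hx e]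
    refine Finset.sum_congr rfl fun i _ => ?_
    rw [hxX, ← KDivF_eq_ikDivF c (hinj i) hy (himg i) hyY, ← himg i,
      Finset.prod_image fun a _ b _ e => hinj i e]
    have hprod : ∏ t ∈ Y, fInv c (x i) t = ∏ m, fInv c (x i) (y m) := by
      conv_lhs => rw [← image_enum Y rfl]
      exact Finset.prod_image fun i _ j _ e => hy e
    rw [hprod]
    rfl
  -- The cardinalities do not match, and every `KDivF` on either side has its default value `0`.
  · rw [KDivF_of_card_ne c (by rw [Finset.card_insert_of_notMem hz]; exact Ne.symm hcard)]
    refine (Finset.sum_eq_zero fun x hx => ?_).symm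
    rw [KDivF_of_card_ne, mul_zero, mul_zero]
    intro e
    exact hcard (by rw [e, Finset.card_erase_add_one hx])

theorem f_neg (c x y : ℂ) : f c (-y) (-x) = f c x y := by rw [f, f, g, g, neg_sub_neg]

theorem h_neg (c x y : ℂ) : h c (-y) (-x) = h c x y := by rw [h, h, neg_sub_neg]

theorem fInv_neg (c x y : ℂ) : fInv c (-y) (-x) = fInv c x y := by
  rw [fInv, fInv, neg_sub_neg]

theorem KDivF_insert_left (c : ℂ) (hc : c ≠ 0) {X Y : Finset ℂ} {x : ℂ} (hx : x ∉ X)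
    (hxY : ∀ y ∈ Y, h c x y ≠ 0) (hXY : ∀ x ∈ X, ∀ y ∈ Y, h c x y ≠ 0) :
    KDivF c (insert x X) Y = ∑ y ∈ Y, (h c x y)⁻¹ * ((∏ y' ∈ Y.erase y, f c y' y) *
      (∏ x' ∈ X, fInv c x' y) * KDivF c X (Y.erase y)) := by
  rw [← KDivF_neg, Finset.image_insert, KDivF_insert_right c hc
    (by simpa using hx) (by simpa [h_neg] using hxY)
    (by simpa [h_neg] using fun y hy x hx => hXY x hx y hy),
    Finset.sum_image fun a _ b _ e => neg_injective e]
  refine Finset.sum_congr rfl fun y _ => ?_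
  rw [h_neg, ← Finset.image_erase neg_injective, KDivF_neg,
    Finset.prod_image fun a _ b _ e => neg_injective e,
    Finset.prod_image fun a _ b _ e => neg_injective e]
  simp only [f_neg, fInv_neg]

theorem sum_erase_erase_comm {α β : Type*} [DecidableEq α] [AddCommMonoid β] (s : Finset α)
    (F : α → α → β) :
    ∑ a ∈ s, ∑ b ∈ s.erase a, F a b = ∑ b ∈ s, ∑ a ∈ s.erase b, F a b :=
  Finset.sum_comm' fun a b => by simp only [Finset.mem_erase]; tauto

theorem prod_erase_eq_mul {s : Finset ℂ} {a b : ℂ} (hb : b ∈ s) (hab : b ≠ a) (F : ℂ → ℂ) :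
    ∏ t ∈ s.erase a, F t = F b * ∏ t ∈ (s.erase a).erase b, F t :=
  (Finset.mul_prod_erase _ _ (Finset.mem_erase.mpr ⟨hab, hb⟩)).symm

/-- Unlike in `KDivF_insert_left`, the products involve only `x` and `Y`, not the rest of `X`.
Induction on `X`: in `{x, x₁} ∪ X` expand first in `x₁` by the known recursion, then in `x` by the
inductive hypothesis. Expanding `x₁` on the right side gives the same double sum, with the order of
summation reversed. -/
theorem KDivF_insert_left' (c : ℂ) (hc : c ≠ 0) {X : Finset ℂ} {x : ℂ} :
    ∀ {Y : Finset ℂ}, x ∉ X →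
    (∀ y ∈ Y, h c x y ≠ 0) → (∀ x ∈ X, ∀ y ∈ Y, h c x y ≠ 0) →
    KDivF c (insert x X) Y = ∑ y ∈ Y, (h c x y)⁻¹ * ((∏ y' ∈ Y.erase y, f c y y') *
      (∏ y' ∈ Y.erase y, fInv c x y') * KDivF c X (Y.erase y)) := by
  induction X using Finset.induction_on with
  | empty =>
    intro Y hx hxY hXY
    rw [KDivF_insert_left c hc hx hxY hXY]
    refine Finset.sum_congr rfl fun y hy => ?_
    by_cases e : Y.erase y = ∅
    · simp [e]
    · rw [KDivF_of_card_ne c (X := ∅) (by simpa using e)]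
      simp
  | insert x₁ X hx₁ ih =>
    intro Y hx hxY hXY
    rw [Finset.mem_insert, not_or] at hx
    rw [Finset.insert_comm, KDivF_insert_left c hc
      (by rw [Finset.mem_insert, not_or]; exact ⟨Ne.symm hx.1, hx₁⟩)
      (hXY x₁ (Finset.mem_insert_self _ _))
      (by
        intro a ha y hy
        rcases Finset.mem_insert.mp ha with rfl | ha
        · exact hxY y hy
        · exact hXY a (Finset.mem_insert_of_mem ha) y hy)]
    have e1 : ∀ y₁ ∈ Y, KDivF c (insert x X) (Y.erase y₁) = _ := fun y₁ _ =>
      ih hx.2 (fun y hy => hxY y (Finset.mem_of_mem_erase hy))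
        (fun a ha y hy => hXY a (Finset.mem_insert_of_mem ha) y (Finset.mem_of_mem_erase hy))
    have e2 : ∀ y ∈ Y, KDivF c (insert x₁ X) (Y.erase y) = _ := fun y _ =>
      KDivF_insert_left c hc hx₁
        (fun y hy => hXY _ (Finset.mem_insert_self _ _) y (Finset.mem_of_mem_erase hy))
        (fun a ha y hy => hXY a (Finset.mem_insert_of_mem ha) y (Finset.mem_of_mem_erase hy))
    refine (Finset.sum_congr rfl fun y₁ h1 => by rw [e1 y₁ h1]).trans (Eq.trans ?_
      (Finset.sum_congr rfl fun y h1 => by rw [e2 y h1]).symm)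
    simp only [Finset.mul_sum]
    rw [sum_erase_erase_comm]
    refine Finset.sum_congr rfl fun y hy => Finset.sum_congr rfl fun y₁ hy₁ => ?_
    obtain ⟨hne, hy₁Y⟩ := Finset.mem_erase.mp hy₁
    rw [Finset.prod_insert hx.2, prod_erase_eq_mul hy (Ne.symm hne) fun t => f c t y₁,
      prod_erase_eq_mul hy₁Y hne fun t => f c y t, prod_erase_eq_mul hy₁Y hne fun t => fInv c x t,
      Finset.erase_right_comm]
    ring

theorem KDivF_insert_right' (c : ℂ) (hc : c ≠ 0) {X Y : Finset ℂ} {z : ℂ} (hz : z ∉ Y)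
    (hXz : ∀ x ∈ X, h c x z ≠ 0) (hXY : ∀ x ∈ X, ∀ y ∈ Y, h c x y ≠ 0) :
    KDivF c X (insert z Y) = ∑ x ∈ X, (h c x z)⁻¹ * ((∏ x' ∈ X.erase x, f c x' x) *
      (∏ x' ∈ X.erase x, fInv c x' z) * KDivF c (X.erase x) Y) := by
  rw [← KDivF_neg, Finset.image_insert, KDivF_insert_left' c hc
    (by simpa using hz) (by simpa [h_neg] using hXz)
    (by simpa [h_neg] using fun y hy x hx => hXY x hx y hy),
    Finset.sum_image fun a _ b _ e => neg_injective e]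
  refine Finset.sum_congr rfl fun y _ => ?_
  rw [h_neg, ← Finset.image_erase neg_injective, KDivF_neg,
    Finset.prod_image fun a _ b _ e => neg_injective e,
    Finset.prod_image fun a _ b _ e => neg_injective e]
  simp only [f_neg, fInv_neg]

/-- The difference of the two expansions of `KDivF c (insert (w - c) X) Y`. -/
theorem sum_g_mul_KDivF_erase (c : ℂ) (hc : c ≠ 0) {X Y : Finset ℂ} {w : ℂ} (hw : w ∉ Y)
    (hXw : ∀ x ∈ X, h c x w ≠ 0) (hXY : ∀ x ∈ X, ∀ y ∈ Y, h c x y ≠ 0) :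
    ∑ y ∈ Y, g c w y * ((∏ y' ∈ Y.erase y, f c y' y) * (∏ x' ∈ X, fInv c x' y) *
        KDivF c X (Y.erase y)) =
      ∑ y ∈ Y, g c w y * ((∏ y' ∈ Y.erase y, f c y y') * (∏ y' ∈ Y.erase y, f c y' w) *
        KDivF c X (Y.erase y)) := by
  have hsub : ∀ y ∈ Y, w - y ≠ 0 := fun y hy => sub_ne_zero.mpr fun e => hw (e ▸ hy)
  -- The extra variable is `w - c`, for which `1/h(w-c,y) = g(w,y)` and `1/f(w-c,y) = f(y,w)`.
  have hx : w - c ∉ X := fun hx => hXw _ hx (by rw [h]; simp)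
  have hh : ∀ y, (h c (w - c) y)⁻¹ = g c w y := fun y => by
    rw [h, g, inv_div]; congr 1; ring
  have hxY : ∀ y ∈ Y, h c (w - c) y ≠ 0 := fun y hy e => by
    rw [← inv_eq_zero, hh, g] at e
    exact div_ne_zero hc (hsub y hy) e
  have hf : ∀ y ∈ Y, fInv c (w - c) y = f c y w := fun y hy => by
    have := hsub y hy
    have h2 : y - w ≠ 0 := by rw [← neg_sub]; exact neg_ne_zero.mpr this
    have h3 : w - c - y + c = w - y := by ring
    rw [fInv, f, g, h3]
    field_simp
    ring
  have h1 := (KDivF_insert_left c hc hx hxY hXY).symm.trans (KDivF_insert_left' c hc hx hxY hXY)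
  simp only [hh] at h1
  rw [h1]
  refine Finset.sum_congr rfl fun y _ => ?_
  rw [Finset.prod_congr rfl fun y' hy' => hf y' (Finset.mem_of_mem_erase hy')]

/-- Induction on `X`, expanding in a new variable `x`. Where `x` is paired with `w`,
`sum_g_mul_KDivF_erase` changes the products to those of the recursion; where it is paired with an
element of `Y`, the inductive hypothesis applies. The recursion for the right side then matches term
by term. The sum is the one that arises when `T₁₃(w)` exchanges its variable with one of the `T₁₂`.
-/
theorem KDivF_exchange (c : ℂ) (hc : c ≠ 0) {w : ℂ} {X : Finset ℂ} :
    ∀ {Y : Finset ℂ}, w ∉ Y →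
    (∀ x ∈ X, h c x w ≠ 0) → (∀ x ∈ X, ∀ y ∈ Y, h c x y ≠ 0) →
    ∑ y ∈ Y, g c w y * ((∏ y' ∈ Y.erase y, f c y y') * KDivF c X (insert w (Y.erase y))) =
      ((∏ y ∈ Y, f c w y) - ∏ x ∈ X, fInv c x w) * KDivF c X Y := by
  induction X using Finset.induction_on with
  | empty =>
    intro Y hw hXw hXY
    by_cases e : Y = ∅
    · simp [e]
    · rw [KDivF_of_card_ne c (X := ∅) (Y := Y) (by simpa using e), mul_zero]
      refine Finset.sum_eq_zero fun y _ => ?_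
      rw [KDivF_of_card_ne c (by simp), mul_zero, mul_zero]
  | insert x X hx ih =>
    intro Y hw hXw hXY
    have hxw := hXw x (Finset.mem_insert_self _ _)
    have hxY := hXY x (Finset.mem_insert_self _ _)
    have hXw' : ∀ x ∈ X, h c x w ≠ 0 := fun a ha => hXw a (Finset.mem_insert_of_mem ha)
    have hXY' : ∀ x ∈ X, ∀ y ∈ Y, h c x y ≠ 0 :=
      fun a ha => hXY a (Finset.mem_insert_of_mem ha)
    have e1 : ∀ y ∈ Y, g c w y * ((∏ y' ∈ Y.erase y, f c y y') *
        KDivF c (insert x X) (insert w (Y.erase y))) =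
        (h c x w)⁻¹ * (∏ x' ∈ X, fInv c x' w) * (g c w y * ((∏ y' ∈ Y.erase y, f c y y') *
          (∏ y' ∈ Y.erase y, f c y' w) * KDivF c X (Y.erase y))) +
        ∑ y₁ ∈ Y.erase y, (h c x y₁)⁻¹ * (∏ y' ∈ Y.erase y₁, f c y' y₁) * f c w y₁ *
          (∏ x' ∈ X, fInv c x' y₁) * (g c w y * ((∏ y' ∈ (Y.erase y₁).erase y, f c y y') *
            KDivF c X (insert w ((Y.erase y₁).erase y)))) := by
      intro y hy
      have hwy : w ∉ Y.erase y := fun h' => hw (Finset.mem_of_mem_erase h')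
      rw [KDivF_insert_left c hc hx
        (Finset.forall_mem_insert _ _ _ |>.mpr
          ⟨hxw, fun y hy => hxY y (Finset.mem_of_mem_erase hy)⟩)
        (fun a ha => Finset.forall_mem_insert _ _ _ |>.mpr
          ⟨hXw' a ha, fun y hy => hXY' a ha y (Finset.mem_of_mem_erase hy)⟩),
        Finset.sum_insert hwy, Finset.erase_insert hwy, mul_add, mul_add, Finset.mul_sum,
        Finset.mul_sum]
      congr 1
      · ring
      · refine Finset.sum_congr rfl fun y₁ hy₁ => ?_
        obtain ⟨hne, hy₁Y⟩ := Finset.mem_erase.mp hy₁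
        have hwy₁ : w ≠ y₁ := fun e => hw (e ▸ hy₁Y)
        rw [Finset.erase_insert_of_ne hwy₁,
          Finset.prod_insert fun h' => hwy (Finset.mem_of_mem_erase h'),
          prod_erase_eq_mul hy₁Y hne fun t => f c y t,
          prod_erase_eq_mul hy (Ne.symm hne) fun t => f c t y₁, Finset.erase_right_comm]
        ring
    rw [Finset.sum_congr rfl e1, Finset.sum_add_distrib, ← Finset.mul_sum,
      ← sum_g_mul_KDivF_erase c hc hw hXw' hXY', sum_erase_erase_comm]
    have e2 : ∀ y₁ ∈ Y, ∑ y ∈ Y.erase y₁,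
        (h c x y₁)⁻¹ * (∏ y' ∈ Y.erase y₁, f c y' y₁) * f c w y₁ *
          (∏ x' ∈ X, fInv c x' y₁) * (g c w y * ((∏ y' ∈ (Y.erase y₁).erase y, f c y y') *
            KDivF c X (insert w ((Y.erase y₁).erase y)))) =
        (h c x y₁)⁻¹ * (∏ y' ∈ Y.erase y₁, f c y' y₁) *
          (∏ x' ∈ X, fInv c x' y₁) * ((∏ y ∈ Y, f c w y) - f c w y₁ * ∏ x ∈ X, fInv c x w) *
            KDivF c X (Y.erase y₁) := by
      intro y₁ hy₁
      rw [← Finset.mul_sum, ih (fun h' => hw (Finset.mem_of_mem_erase h')) hXw'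
        (fun a ha y hy => hXY' a ha y (Finset.mem_of_mem_erase hy)),
        ← Finset.mul_prod_erase Y _ hy₁]
      ring
    rw [Finset.sum_congr rfl e2, KDivF_insert_left c hc hx hxY hXY', Finset.mul_sum,
      Finset.mul_sum, ← Finset.sum_add_distrib]
    refine Finset.sum_congr rfl fun y hy => ?_
    have hxy := hxY y hy
    have hwy : w - y ≠ 0 := sub_ne_zero.mpr fun e => hw (e ▸ hy)
    -- All that is left of the identity for each `y`, after the common products are taken out.
    have key : (h c x w)⁻¹ * g c w y + (h c x y)⁻¹ * (fInv c x w - f c w y) = 0 := by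
      have e1 : x - w + c ≠ 0 := fun e => hxw (by rw [h, e, zero_div])
      have e2 : x - y + c ≠ 0 := fun e => hxy (by rw [h, e, zero_div])
      rw [h, h, f, fInv, g]
      field_simp
      ring
    rw [Finset.prod_insert hx]
    linear_combination ((∏ x' ∈ X, fInv c x' w) * (∏ y' ∈ Y.erase y, f c y' y) *
      (∏ x' ∈ X, fInv c x' y) * KDivF c X (Y.erase y)) * key

/-! ### Sums over subsets -/

/-- The bijection `(I, a) ↦ (I ∪ {a}, a)`. A set enlarged by one element becomes a set with a marked
element, and the recursions for `KDivF` are sums over the marked element. -/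
theorem sum_powersetCard_sdiff {α β : Type*} [DecidableEq α] [AddCommMonoid β] (s : Finset α)
    (n : ℕ) (F : α → Finset α → β) :
    ∑ I ∈ s.powersetCard n, ∑ a ∈ s \ I, F a I =
      ∑ J ∈ s.powersetCard (n + 1), ∑ a ∈ J, F a (J.erase a) := by
  rw [Finset.sum_sigma', Finset.sum_sigma']
  refine Finset.sum_bij' (fun p _ => ⟨insert p.2 p.1, p.2⟩) (fun p _ => ⟨p.1.erase p.2, p.2⟩)
    ?_ ?_ ?_ ?_ ?_
  · rintro ⟨I, a⟩ hp
    simp only [Finset.mem_sigma, Finset.mem_powersetCard, Finset.mem_sdiff] at hp ⊢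
    obtain ⟨⟨h1, h2⟩, h3, h4⟩ := hp
    exact ⟨⟨Finset.insert_subset h3 h1, by rw [Finset.card_insert_of_notMem h4, h2]⟩,
      Finset.mem_insert_self _ _⟩
  · rintro ⟨J, a⟩ hp
    simp only [Finset.mem_sigma, Finset.mem_powersetCard, Finset.mem_sdiff] at hp ⊢
    obtain ⟨⟨h1, h2⟩, h3⟩ := hp
    exact ⟨⟨(Finset.erase_subset _ _).trans h1, by rw [Finset.card_erase_of_mem h3, h2]; rfl⟩,
      h1 h3, Finset.notMem_erase _ _⟩
  · rintro ⟨I, a⟩ hp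
    simp only [Finset.mem_sigma, Finset.mem_sdiff] at hp
    simp [Finset.erase_insert hp.2.2]
  · rintro ⟨J, a⟩ hp
    simp only [Finset.mem_sigma] at hp
    simp [Finset.insert_erase hp.2]
  · rintro ⟨I, a⟩ hp
    simp only [Finset.mem_sigma, Finset.mem_sdiff] at hp
    simp [Finset.erase_insert hp.2.2]

theorem sum_powerset_sdiff {α β : Type*} [DecidableEq α] [AddCommMonoid β] (s : Finset α)
    (F : α → Finset α → β) :
    ∑ I ∈ s.powerset, ∑ a ∈ s \ I, F a I = ∑ J ∈ s.powerset, ∑ a ∈ J, F a (J.erase a) := by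
  rw [Finset.sum_sigma', Finset.sum_sigma']
  refine Finset.sum_bij' (fun p _ => ⟨insert p.2 p.1, p.2⟩) (fun p _ => ⟨p.1.erase p.2, p.2⟩)
    ?_ ?_ ?_ ?_ ?_
  · rintro ⟨I, a⟩ hp
    simp only [Finset.mem_sigma, Finset.mem_powerset, Finset.mem_sdiff] at hp ⊢
    exact ⟨Finset.insert_subset hp.2.1 hp.1, Finset.mem_insert_self _ _⟩
  · rintro ⟨J, a⟩ hp
    simp only [Finset.mem_sigma, Finset.mem_powerset, Finset.mem_sdiff] at hp ⊢
    exact ⟨(Finset.erase_subset _ _).trans hp.1, hp.1 hp.2, Finset.notMem_erase _ _⟩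
  · rintro ⟨I, a⟩ hp
    simp only [Finset.mem_sigma, Finset.mem_sdiff] at hp
    simp [Finset.erase_insert hp.2.2]
  · rintro ⟨J, a⟩ hp
    simp only [Finset.mem_sigma] at hp
    simp [Finset.insert_erase hp.2]
  · rintro ⟨I, a⟩ hp
    simp only [Finset.mem_sigma, Finset.mem_sdiff] at hp
    simp [Finset.erase_insert hp.2.2]

theorem sum_powerset_erase {α β : Type*} [DecidableEq α] [AddCommMonoid β] (s : Finset α)
    (F : α → Finset α → β) :
    ∑ a ∈ s, ∑ I ∈ (s.erase a).powerset, F a I =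
      ∑ J ∈ s.powerset, ∑ a ∈ J, F a (J.erase a) := by
  rw [← sum_powerset_sdiff]
  refine Finset.sum_comm' fun a I => ?_
  rw [Finset.mem_powerset, Finset.mem_powerset, Finset.subset_erase, Finset.mem_sdiff]
  tauto

theorem fProd_insert_left (c : ℂ) {x : ℂ} {X : Finset ℂ} (Y : Finset ℂ) (hx : x ∉ X) :
    fProd c (insert x X) Y = (∏ y ∈ Y, f c x y) * fProd c X Y := Finset.prod_insert hx

theorem fProd_insert_right (c : ℂ) (X : Finset ℂ) {y : ℂ} {Y : Finset ℂ} (hy : y ∉ Y) :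
    fProd c X (insert y Y) = (∏ x ∈ X, f c x y) * fProd c X Y := by
  simp only [fProd, Finset.prod_insert hy, Finset.prod_mul_distrib]

theorem fInvProd_insert_right (c : ℂ) (X : Finset ℂ) {y : ℂ} {Y : Finset ℂ} (hy : y ∉ Y) :
    fInvProd c X (insert y Y) = (∏ x ∈ X, fInv c x y) * fInvProd c X Y := by
  simp only [fInvProd, Finset.prod_insert hy, Finset.prod_mul_distrib]

theorem f_mul_fInv (c : ℂ) {x y : ℂ} (hxy : x ≠ y) (hf : x - y ≠ -c) :
    f c x y * fInv c x y = 1 := by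
  have h1 := sub_ne_zero.mpr hxy
  have h2 : x - y + c ≠ 0 := fun e => hf (eq_neg_of_add_eq_zero_left e)
  rw [f, g, fInv]
  field_simp

namespace HighestWeightRep

variable {c : ℂ} {V : Type*} [AddCommGroup V] [Module ℂ V]

/-! ### Sets of generic spectral parameters at which `λ₂` is normalized to `1` -/

/-- `S` consists of admissible spectral parameters with `λ₂ = 1`, no two of which differ by `c`. -/
structure IsNormalizedOn (M : HighestWeightRep c V) (S : Set ℂ) : Prop where
  mem_D : ∀ x ∈ S, x ∈ M.D
  lam_eq_one : ∀ x ∈ S, M.lam 1 x = 1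
  sub_ne : ∀ x ∈ S, ∀ y ∈ S, x - y ≠ c

variable {M : HighestWeightRep c V} {S : Set ℂ}

namespace IsNormalizedOn

theorem add_ne_zero (hS : M.IsNormalizedOn S) {x y : ℂ} (hx : x ∈ S) (hy : y ∈ S) :
    x - y + c ≠ 0 := fun e => hS.sub_ne y hy x hx (by linear_combination -e)

theorem h_ne_zero (hS : M.IsNormalizedOn S) (hc : c ≠ 0) {x y : ℂ} (hx : x ∈ S) (hy : y ∈ S) :
    h c x y ≠ 0 := div_ne_zero (hS.add_ne_zero hx hy) hc

theorem f_mul_fInv (hS : M.IsNormalizedOn S) {x y : ℂ} (hx : x ∈ S) (hy : y ∈ S) (hxy : x ≠ y) :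
    f c x y * fInv c x y = 1 :=
  GL3.f_mul_fInv c hxy fun e => hS.add_ne_zero hx hy (by rw [e, neg_add_cancel])

theorem f_ne_zero (hS : M.IsNormalizedOn S) {x y : ℂ} (hx : x ∈ S) (hy : y ∈ S) (hxy : x ≠ y) :
    f c x y ≠ 0 := left_ne_zero_of_mul_eq_one (hS.f_mul_fInv hx hy hxy)

theorem prod_f_mul_prod_fInv (hS : M.IsNormalizedOn S) {X : Finset ℂ} {w : ℂ}
    (hX : ∀ x ∈ X, x ∈ S) (hw : w ∈ S) (hwX : w ∉ X) :
    (∏ x ∈ X, f c x w) * ∏ x ∈ X, fInv c x w = 1 := by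
  rw [← Finset.prod_mul_distrib]
  exact Finset.prod_eq_one fun x hx => hS.f_mul_fInv (hX x hx) hw fun e => hwX (e ▸ hx)

theorem commutation (hS : M.IsNormalizedOn S) {x y : ℂ} (hx : x ∈ S) (hy : y ∈ S) (hxy : x ≠ y)
    (i j k l : Fin 3) : M.T x i j * M.T y k l =
      M.T y k l * M.T x i j + g c x y • (M.T y k j * M.T x i l - M.T x k j * M.T y i l) := by
  rw [← M.commutation (hS.mem_D x hx) (hS.mem_D y hy) hxy (hS.f_ne_zero hx hy hxy) i j k l]
  abel

theorem TProd_insert (hS : M.IsNormalizedOn S) (i j : Fin 3) {x : ℂ} {X : Finset ℂ}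
    (hx : x ∈ S) (hX : ∀ x ∈ X, x ∈ S) (hxX : x ∉ X) :
    M.TProd i j (insert x X) = M.T x i j * M.TProd i j X := by
  have hp : List.Perm ((insert x X).toList.map fun x => M.T x i j)
      ((x :: X.toList).map fun x => M.T x i j) :=
    (Finset.toList_insert hxX).map _
  unfold TProd
  rw [hp.prod_eq', List.map_cons, List.prod_cons]
  rw [List.pairwise_map]
  have hmem : ∀ a ∈ insert x X, a ∈ S := by simpa using ⟨hx, hX⟩
  refine (Finset.nodup_toList _).imp_of_mem fun {a b} ha hb hab => ?_
  rw [Finset.mem_toList] at ha hb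
  exact M.commute_T (hS.mem_D _ (hmem a ha)) (hS.mem_D _ (hmem b hb))
    (hS.f_ne_zero (hmem a ha) (hmem b hb) hab) i j

theorem lam2_eq_one (hS : M.IsNormalizedOn S) {X : Finset ℂ} (hX : ∀ x ∈ X, x ∈ S) :
    M.lam2 X = 1 := Finset.prod_eq_one fun x hx => hS.lam_eq_one x (hX x hx)

end IsNormalizedOn

/-- The term `T₁₂(A) T₁₃(B) T₂₃(C) |0⟩` of the Bethe vector. -/
def monomial (M : HighestWeightRep c V) (A B C : Finset ℂ) : V :=
  (M.TProd 0 1 A * M.TProd 0 2 B * M.TProd 1 2 C) M.vac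

namespace IsNormalizedOn

theorem betheVector_eq (hS : M.IsNormalizedOn S) {u v : Finset ℂ} (hu : ∀ x ∈ u, x ∈ S)
    (hv : ∀ x ∈ v, x ∈ S) : M.betheVector u v =
    ∑ uI ∈ u.powerset, ∑ vI ∈ v.powerset,
      (KDivF c vI uI * (fProd c (v \ vI) vI * fProd c (u \ uI) uI * fInvProd c (v \ vI) u)) •
      M.monomial (u \ uI) uI (v \ vI) := by
  unfold betheVector
  refine Finset.sum_congr rfl fun uI _ => ?_
  rw [Finset.sum_filter]
  refine Finset.sum_congr rfl fun vI _ => ?_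
  rw [hS.lam2_eq_one hu, hS.lam2_eq_one fun x hx => hv x (Finset.sdiff_subset hx), mul_one,
    div_one]
  split_ifs with e
  · rfl
  · rw [KDivF_of_card_ne c (Ne.symm e), zero_mul, zero_smul]

/-! ### Moving `T₁₃(w)` through products of `T₁₂` -/

theorem T02_mul_T01 (hS : M.IsNormalizedOn S) {x y : ℂ} (hx : x ∈ S) (hy : y ∈ S) (hxy : x ≠ y) :
    M.T x 0 2 * M.T y 0 1 =
      f c y x • (M.T y 0 1 * M.T x 0 2) + g c x y • (M.T x 0 1 * M.T y 0 2) := by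
  have h1 := hS.commutation hy hx hxy.symm 0 1 0 2
  have h2 : g c y x = - g c x y := by rw [g, g, ← neg_sub, div_neg]
  rw [f]
  rw [h2] at h1 ⊢
  linear_combination (norm := module) -h1

/-- Either `w` passes every factor, or it ends up exchanged with a single `u`. The induction needs
all `w` at once, because after an exchange it is `T₁₃(x)` that moves on. -/
theorem T02_mul_TProd (hS : M.IsNormalizedOn S) {U : Finset ℂ} :
    ∀ {w : ℂ}, (∀ x ∈ U, x ∈ S) → w ∈ S → w ∉ U →
    M.T w 0 2 * M.TProd 0 1 U = (∏ u ∈ U, f c u w) • (M.TProd 0 1 U * M.T w 0 2) +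
      ∑ u ∈ U, (g c w u * ∏ u' ∈ U.erase u, f c u' u) •
        (M.T w 0 1 * (M.TProd 0 1 (U.erase u) * M.T u 0 2)) := by
  induction U using Finset.induction_on with
  | empty => intro w _ _ _; simp [TProd]
  | insert x U hx ih =>
    intro w hU hw hwU
    rw [Finset.mem_insert, not_or] at hwU
    have hxS := hU x (Finset.mem_insert_self _ _)
    have hUS : ∀ x ∈ U, x ∈ S := fun y hy => hU y (Finset.mem_insert_of_mem hy)
    have i1 := ih hUS hw hwU.2
    have i2 := ih hUS hxS hx
    have e1 : ∀ u ∈ U, (insert x U).erase u = insert x (U.erase u) := fun u hu =>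
      Finset.erase_insert_of_ne fun e => hx (e ▸ hu)
    have hAA : M.T x 0 1 * M.T w 0 1 = M.T w 0 1 * M.T x 0 1 :=
      M.commute_T (hS.mem_D _ hxS) (hS.mem_D _ hw) (hS.f_ne_zero hxS hw (Ne.symm hwU.1)) 0 1
    rw [hS.TProd_insert 0 1 hxS hUS hx, ← mul_assoc, hS.T02_mul_T01 hw hxS hwU.1, add_mul,
      smul_mul_assoc, smul_mul_assoc, mul_assoc, mul_assoc, i1, i2, mul_add, mul_add,
      Finset.mul_sum, Finset.mul_sum, Finset.prod_insert hx, Finset.sum_insert hx,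
      Finset.erase_insert hx]
    have e2 : ∀ u ∈ U, (g c w u * ∏ u' ∈ (insert x U).erase u, f c u' u) •
        (M.T w 0 1 * (M.TProd 0 1 ((insert x U).erase u) * M.T u 0 2)) =
        f c x w • (M.T x 0 1 * ((g c w u * ∏ u' ∈ U.erase u, f c u' u) •
          (M.T w 0 1 * (M.TProd 0 1 (U.erase u) * M.T u 0 2)))) +
        g c w x • (M.T w 0 1 * ((g c x u * ∏ u' ∈ U.erase u, f c u' u) •
          (M.T x 0 1 * (M.TProd 0 1 (U.erase u) * M.T u 0 2)))) := by
      intro u hu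
      have hxu : x ∉ U.erase u := fun h' => hx (Finset.mem_of_mem_erase h')
      rw [e1 u hu, hS.TProd_insert 0 1 hxS (fun y hy => hUS y (Finset.mem_of_mem_erase hy)) hxu,
        Finset.prod_insert hxu, mul_smul_comm, mul_smul_comm, ← mul_assoc (M.T x 0 1), hAA,
        mul_assoc, mul_assoc, smul_smul, smul_smul, ← add_smul]
      congr 1
      have h1 := sub_ne_zero.mpr hwU.1
      have h2 : x - u ≠ 0 := sub_ne_zero.mpr fun e => hx (e ▸ hu)
      have h3 : w - u ≠ 0 := sub_ne_zero.mpr fun e => hwU.2 (e ▸ hu)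
      -- The exchange with `u` arises in two ways: `w` passes `x` and is exchanged with `u`, or `w`
      -- is exchanged with `x` and then `x` with `u`.
      have h4 : g c w u * f c x u = f c x w * g c w u + g c w x * g c x u := by
        rw [f, f, g, g, g, g, ← neg_sub w x, div_neg]
        field_simp
        ring
      linear_combination (∏ u' ∈ U.erase u, f c u' u) * h4
    rw [Finset.sum_congr rfl e2, Finset.sum_add_distrib, ← Finset.smul_sum, ← Finset.smul_sum]
    simp only [mul_smul_comm, mul_assoc, smul_add, smul_smul]
    abel

theorem T02_monomial (hS : M.IsNormalizedOn S) {A B C : Finset ℂ} {w : ℂ}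
    (hA : ∀ x ∈ A, x ∈ S) (hB : ∀ x ∈ B, x ∈ S) (hw : w ∈ S) (hwA : w ∉ A) (hwB : w ∉ B)
    (hAB : Disjoint A B) :
    M.T w 0 2 (M.monomial A B C) = (∏ a ∈ A, f c a w) • M.monomial A (insert w B) C +
      ∑ a ∈ A, (g c w a * ∏ a' ∈ A.erase a, f c a' a) •
        M.monomial (insert w (A.erase a)) (insert a B) C := by
  have h1 : ∀ a ∈ A, M.monomial (insert w (A.erase a)) (insert a B) C =
      (M.T w 0 1 * (M.TProd 0 1 (A.erase a) * M.T a 0 2) * (M.TProd 0 2 B * M.TProd 1 2 C))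
        M.vac := fun a ha => by
    rw [monomial, hS.TProd_insert 0 1 hw (fun y hy => hA y (Finset.mem_of_mem_erase hy))
      (fun h' => hwA (Finset.mem_of_mem_erase h')),
      hS.TProd_insert 0 2 (hA a ha) hB (Finset.disjoint_left.mp hAB ha)]
    simp only [mul_assoc]
  rw [Finset.sum_congr rfl fun a ha => by rw [h1 a ha], monomial, monomial,
    hS.TProd_insert 0 2 hw hB hwB, ← Module.End.mul_apply, mul_assoc (M.TProd 0 1 A),
    ← mul_assoc (M.T w 0 2), hS.T02_mul_TProd hA hw hwA, add_mul, LinearMap.add_apply,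
    Finset.sum_mul, LinearMap.sum_apply]
  simp only [smul_mul_assoc, LinearMap.smul_apply, mul_assoc]

end IsNormalizedOn

end HighestWeightRep

theorem erase_sdiff_erase_of_mem {α : Type*} [DecidableEq α] {s t : Finset α} {a : α}
    (ha : a ∈ t) : s.erase a \ t.erase a = s \ t := by
  ext y
  by_cases e : y = a <;> simp [e, ha]

theorem sdiff_erase_eq_insert {α : Type*} [DecidableEq α] {s t : Finset α} {a : α}
    (hs : a ∈ s) : s \ t.erase a = insert a (s \ t) := by
  ext y
  by_cases e : y = a <;> simp [e, hs]

theorem fProd_erase_mul (c : ℂ) (Z : Finset ℂ) {J : Finset ℂ} {x : ℂ} (hx : x ∈ J) :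
    (∏ z ∈ Z, f c z x) * fProd c Z (J.erase x) = fProd c Z J := by
  rw [← fProd_insert_right c Z (Finset.notMem_erase x J), Finset.insert_erase hx]

namespace HighestWeightRep.IsNormalizedOn

variable {c : ℂ} {V : Type*} [AddCommGroup V] [Module ℂ V] {M : HighestWeightRep c V} {S : Set ℂ}

/-! ### Recursion of the Bethe vectors in the first set of variables -/

/-- `KDivF_insert_right'` sums over the element `x` that is paired with `w`. The result has the
coefficients of `B(u∪w; v)` with `w` in `u_I`, up to the factor `f(u_II, w)`, which appears once
`T₁₃(w)` is moved into place. -/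
theorem sum_T02_betheVector_erase (hS : M.IsNormalizedOn S) (hc : c ≠ 0) {u v : Finset ℂ} {w : ℂ}
    (hu : ∀ x ∈ u, x ∈ S) (hv : ∀ x ∈ v, x ∈ S) (hw : w ∈ S) (hwu : w ∉ u) :
    ∑ x ∈ v, ((h c x w)⁻¹ * ((∏ x' ∈ v.erase x, f c x' x) * ∏ x' ∈ v.erase x, fInv c x' w)) •
      M.T w 0 2 (M.betheVector u (v.erase x)) =
    ∑ uI ∈ u.powerset, ∑ vI ∈ v.powerset,
      (KDivF c vI (insert w uI) * (fProd c (v \ vI) vI * fProd c (u \ uI) uI *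
        fInvProd c (v \ vI) (insert w u))) • M.T w 0 2 (M.monomial (u \ uI) uI (v \ vI)) := by
  have e1 : ∀ x ∈ v, ((h c x w)⁻¹ * ((∏ x' ∈ v.erase x, f c x' x) *
      ∏ x' ∈ v.erase x, fInv c x' w)) • M.T w 0 2 (M.betheVector u (v.erase x)) =
      ∑ uI ∈ u.powerset, ∑ vI ∈ (v.erase x).powerset,
        ((h c x w)⁻¹ * ((∏ x' ∈ v.erase x, f c x' x) * ∏ x' ∈ v.erase x, fInv c x' w) *
        (KDivF c vI uI * (fProd c (v.erase x \ vI) vI * fProd c (u \ uI) uI *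
          fInvProd c (v.erase x \ vI) u))) •
        M.T w 0 2 (M.monomial (u \ uI) uI (v.erase x \ vI)) := by
    intro x _
    rw [hS.betheVector_eq hu fun y hy => hv y (Finset.mem_of_mem_erase hy)]
    simp only [map_sum, map_smul, Finset.smul_sum, smul_smul]
  rw [Finset.sum_congr rfl e1, Finset.sum_comm]
  refine Finset.sum_congr rfl fun uI huI => ?_
  have huI' := Finset.mem_powerset.mp huI
  rw [sum_powerset_erase]
  refine Finset.sum_congr rfl fun vI hvI => ?_
  have hvI' := Finset.mem_powerset.mp hvI
  rw [KDivF_insert_right' c hc (fun h' => hwu (huI' h'))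
    (fun x hx => hS.h_ne_zero hc (hv x (hvI' hx)) hw)
    (fun x hx y hy => hS.h_ne_zero hc (hv x (hvI' hx)) (hu y (huI' hy))), Finset.sum_mul,
    Finset.sum_smul]
  refine Finset.sum_congr rfl fun x hx => ?_
  have hsplit : ∀ F : ℂ → ℂ, ∏ y ∈ v.erase x, F y = (∏ y ∈ v \ vI, F y) * ∏ y ∈ vI.erase x, F y := by
    intro F
    rw [← erase_sdiff_erase_of_mem hx, Finset.prod_sdiff (Finset.erase_subset_erase x hvI')]
  rw [erase_sdiff_erase_of_mem hx, fInvProd_insert_right c _ hwu, hsplit, hsplit,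
    ← fProd_erase_mul c (v \ vI) hx]
  congr 1
  ring

theorem T01_monomial (hS : M.IsNormalizedOn S) {A : Finset ℂ} (B C : Finset ℂ) {w : ℂ}
    (hA : ∀ x ∈ A, x ∈ S) (hw : w ∈ S) (hwA : w ∉ A) :
    M.T w 0 1 (M.monomial A B C) = M.monomial (insert w A) B C := by
  rw [monomial, monomial, hS.TProd_insert 0 1 hw hA hwA]
  simp only [mul_assoc, Module.End.mul_apply]

/-- The terms of the left side with `w ∈ u_I` are those where `T₁₃(w)` passes all `T₁₂` without
exchange. The exchanged terms have `w` in `u_II`, and `KDivF_exchange` sums them to `f(w,u_I) -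
1/f(v_I,w)`, times `K/f`. The first part is what the left side requires, and the second cancels
against `T₁₂(w) B(u; v)`. -/
theorem betheVector_insert_left (hS : M.IsNormalizedOn S) (hc : c ≠ 0) {u v : Finset ℂ} {w : ℂ}
    (hu : ∀ x ∈ u, x ∈ S) (hv : ∀ x ∈ v, x ∈ S) (hw : w ∈ S) (hwu : w ∉ u) :
    M.betheVector (insert w u) v = (∏ x ∈ v, fInv c x w) • M.T w 0 1 (M.betheVector u v) +
      ∑ x ∈ v, ((h c x w)⁻¹ * ((∏ x' ∈ v.erase x, f c x' x) * ∏ x' ∈ v.erase x, fInv c x' w)) •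
        M.T w 0 2 (M.betheVector u (v.erase x)) := by
  rw [hS.sum_T02_betheVector_erase hc hu hv hw hwu, hS.betheVector_eq
    (Finset.forall_mem_insert _ _ _ |>.mpr ⟨hw, hu⟩) hv, Finset.sum_powerset_insert hwu,
    hS.betheVector_eq hu hv]
  have e1 : ∀ uI ∈ u.powerset, ∀ vI ∈ v.powerset,
      (KDivF c vI (insert w uI) * (fProd c (v \ vI) vI * fProd c (u \ uI) uI *
        fInvProd c (v \ vI) (insert w u))) • M.T w 0 2 (M.monomial (u \ uI) uI (v \ vI)) =
      (KDivF c vI (insert w uI) * (fProd c (v \ vI) vI *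
        fProd c (insert w u \ insert w uI) (insert w uI) * fInvProd c (v \ vI) (insert w u))) •
          M.monomial (insert w u \ insert w uI) (insert w uI) (v \ vI) +
      ∑ a ∈ u \ uI, (KDivF c vI (insert w uI) * (fProd c (v \ vI) vI * fProd c (u \ uI) uI *
        fInvProd c (v \ vI) (insert w u)) * (g c w a * ∏ a' ∈ (u \ uI).erase a, f c a' a)) •
        M.monomial (insert w ((u \ uI).erase a)) (insert a uI) (v \ vI) := by
    intro uI huI vI _
    have huI' := Finset.mem_powerset.mp huI
    have hset : insert w u \ insert w uI = u \ uI := by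
      ext y
      by_cases e : y = w <;> simp [e, hwu]
    rw [hset, hS.T02_monomial (fun y hy => hu y (Finset.sdiff_subset hy))
      (fun y hy => hu y (huI' hy)) hw (fun h' => hwu (Finset.sdiff_subset h'))
      (fun h' => hwu (huI' h')) Finset.sdiff_disjoint, smul_add, smul_smul, Finset.smul_sum,
      fProd_insert_right c (u \ uI) fun h' => hwu (huI' h')]
    simp only [smul_smul]
    congr 2
    ring
  rw [Finset.sum_congr rfl fun uI huI => Finset.sum_congr rfl fun vI hvI => e1 uI huI vI hvI]
  simp only [Finset.sum_add_distrib]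
  -- The part with `w ∈ u_I` is split off on both sides; the part with `w ∈ u_II` remains.
  rw [add_comm (∑ uI ∈ u.powerset, ∑ vI ∈ v.powerset, _), add_left_comm]
  congr 1
  rw [Finset.sum_comm (s := u.powerset) (t := v.powerset),
    Finset.sum_comm (s := u.powerset) (t := v.powerset)]
  simp only [map_sum, Finset.smul_sum]
  rw [Finset.sum_comm (s := u.powerset) (t := v.powerset), ← Finset.sum_add_distrib]
  refine Finset.sum_congr rfl fun vI hvI => ?_
  have hvI' := Finset.mem_powerset.mp hvI
  rw [sum_powerset_sdiff, ← Finset.sum_add_distrib]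
  refine Finset.sum_congr rfl fun uI huI => ?_
  have huI' := Finset.mem_powerset.mp huI
  have hwII : w ∉ u \ uI := fun h' => hwu (Finset.sdiff_subset h')
  have e2 : ∀ a ∈ uI, (KDivF c vI (insert w (uI.erase a)) * (fProd c (v \ vI) vI *
      fProd c (u \ uI.erase a) (uI.erase a) * fInvProd c (v \ vI) (insert w u)) *
        (g c w a * ∏ a' ∈ (u \ uI.erase a).erase a, f c a' a)) •
      M.monomial (insert w ((u \ uI.erase a).erase a)) (insert a (uI.erase a)) (v \ vI) =
      ((fProd c (v \ vI) vI * fProd c (u \ uI) uI * fInvProd c (v \ vI) (insert w u)) *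
        (g c w a * ((∏ a' ∈ uI.erase a, f c a a') * KDivF c vI (insert w (uI.erase a))))) •
      M.monomial (insert w (u \ uI)) uI (v \ vI) := by
    intro a ha
    have haII : a ∉ u \ uI := fun h' => (Finset.mem_sdiff.mp h').2 ha
    rw [sdiff_erase_eq_insert (huI' ha), Finset.erase_insert haII, Finset.insert_erase ha,
      fProd_insert_left c _ haII, ← fProd_erase_mul c (u \ uI) ha]
    congr 1
    ring
  rw [Finset.sum_congr rfl e2, ← Finset.sum_smul, ← Finset.mul_sum,
    KDivF_exchange c hc (fun h' => hwu (huI' h')) (fun x hx => hS.h_ne_zero hc (hv x (hvI' hx)) hw)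
    (fun x hx y hy => hS.h_ne_zero hc (hv x (hvI' hx)) (hu y (huI' hy))), map_smul,
    hS.T01_monomial _ _ (fun y hy => hu y (Finset.sdiff_subset hy)) hw hwII, smul_smul,
    ← add_smul, Finset.insert_sdiff_of_notMem _ (fun h' => hwu (huI' h')),
    fProd_insert_left c _ hwII, fInvProd_insert_right c _ hwu, ← Finset.prod_sdiff hvI']
  congr 1
  ring

end HighestWeightRep.IsNormalizedOn

/-! ### Coefficients for removing one variable -/

/-- The product `∏ f(p,y)` over the `y ∈ η` other than `p`. -/
def fLeft (c : ℂ) (η : Finset ℂ) (p : ℂ) : ℂ := ∏ y ∈ η.erase p, f c p y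

/-- The product `∏ f(y,q)` over the `y ∈ ξ` other than `q`. -/
def fRight (c : ℂ) (ξ : Finset ℂ) (q : ℂ) : ℂ := ∏ y ∈ ξ.erase q, f c y q

theorem h_self_inv (c : ℂ) (hc : c ≠ 0) (x : ℂ) : (h c x x)⁻¹ = 1 := by
  rw [h, sub_self, zero_add, div_self hc, inv_one]

theorem fInv_self (c x : ℂ) : fInv c x x = 0 := by rw [fInv, sub_self, zero_div]

theorem insert_erase_comm {α : Type*} [DecidableEq α] {s : Finset α} {a b : α} (ha : a ∉ s)
    (hb : b ∈ s) : insert a (s.erase b) = (insert a s).erase b :=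
  (Finset.erase_insert_of_ne (ne_of_mem_of_not_mem hb ha).symm).symm

namespace HighestWeightRep.IsNormalizedOn

variable {c : ℂ} {V : Type*} [AddCommGroup V] [Module ℂ V] {M : HighestWeightRep c V} {S : Set ℂ}

theorem fLeft_eq (hS : M.IsNormalizedOn S) {η : Finset ℂ} {z p : ℂ} (hη : ∀ x ∈ η, x ∈ S)
    (hz : z ∈ S) (hp : p ∈ η) (hzη : z ∉ η) :
    fLeft c η p = fLeft c (insert z η) p * fInv c p z := by
  have hpz : p ≠ z := fun e => hzη (e ▸ hp)
  rw [fLeft, fLeft, ← insert_erase_comm hzη hp,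
    Finset.prod_insert fun h' => hzη (Finset.mem_of_mem_erase h')]
  linear_combination (-(∏ y ∈ η.erase p, f c p y)) * hS.f_mul_fInv (hη p hp) hz hpz

theorem fRight_eq (hS : M.IsNormalizedOn S) {ξ : Finset ℂ} {z q : ℂ} (hξ : ∀ x ∈ ξ, x ∈ S)
    (hz : z ∈ S) (hq : q ∈ ξ) (hzξ : z ∉ ξ) :
    fRight c ξ q = fRight c (insert z ξ) q * fInv c z q := by
  have hpz : q ≠ z := fun e => hzξ (e ▸ hq)
  rw [fRight, fRight, ← insert_erase_comm hzξ hq,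
    Finset.prod_insert fun h' => hzξ (Finset.mem_of_mem_erase h')]
  linear_combination (-(∏ y ∈ ξ.erase q, f c y q)) * hS.f_mul_fInv hz (hξ q hq) hpz.symm

/-- The added term `p = z` is zero because `1/f(z,z) = 0`. It lets the results of applying operators
in `w` and `z` in either order run over the same set, to be compared term by term. -/
theorem sum_fLeft_smul {W : Type*} [AddCommGroup W] [Module ℂ W] (hS : M.IsNormalizedOn S)
    {η : Finset ℂ} {z : ℂ} (hη : ∀ x ∈ η, x ∈ S)
    (hz : z ∈ S) (hzη : z ∉ η) (a : ℂ → ℂ) (G G' : ℂ → W) (hG : ∀ p ∈ η, G p = G' p) :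
    ∑ p ∈ η, (a p * fLeft c η p) • G p =
      ∑ p ∈ insert z η, (a p * fInv c p z * fLeft c (insert z η) p) • G' p := by
  rw [Finset.sum_insert hzη, fInv_self, mul_zero, zero_mul, zero_smul, zero_add]
  refine Finset.sum_congr rfl fun p hp => ?_
  rw [hS.fLeft_eq hη hz hp hzη, hG p hp]
  congr 1
  ring

theorem sum_fRight_smul {W : Type*} [AddCommGroup W] [Module ℂ W] (hS : M.IsNormalizedOn S)
    {ξ : Finset ℂ} {z : ℂ} (hξ : ∀ x ∈ ξ, x ∈ S)
    (hz : z ∈ S) (hzξ : z ∉ ξ) (a : ℂ → ℂ) (G G' : ℂ → W) (hG : ∀ p ∈ ξ, G p = G' p) :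
    ∑ q ∈ ξ, (a q * fRight c ξ q) • G q =
      ∑ q ∈ insert z ξ, (a q * fInv c z q * fRight c (insert z ξ) q) • G' q := by
  rw [Finset.sum_insert hzξ, fInv_self, mul_zero, zero_mul, zero_smul, zero_add]
  refine Finset.sum_congr rfl fun p hp => ?_
  rw [hS.fRight_eq hξ hz hp hzξ, hG p hp]
  congr 1
  ring

/-! ### Actions of single operators on Bethe vectors -/

/-- In `betheVector_insert_left` with `w` also in the second set, the zero of `1/f(w,w)` kills every
term except the one that removes `w`. -/
theorem T02_betheVector (hS : M.IsNormalizedOn S) (hc : c ≠ 0) {u v : Finset ℂ} {w : ℂ}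
    (hu : ∀ x ∈ u, x ∈ S) (hv : ∀ x ∈ v, x ∈ S) (hw : w ∈ S) (hwu : w ∉ u) (hwv : w ∉ v) :
    M.T w 0 2 (M.betheVector u v) = M.betheVector (insert w u) (insert w v) := by
  rw [hS.betheVector_insert_left hc hu ((Finset.forall_mem_insert _ _ _).mpr ⟨hw, hv⟩) hw hwu,
    Finset.prod_insert hwv, fInv_self, zero_mul, zero_smul, zero_add, Finset.sum_insert hwv,
    Finset.erase_insert hwv, h_self_inv c hc, hS.prod_f_mul_prod_fInv hv hw hwv, one_mul,
    one_smul, left_eq_add]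
  refine Finset.sum_eq_zero fun x hx => ?_
  have hxw : x ≠ w := fun e => hwv (e ▸ hx)
  rw [Finset.prod_eq_zero (f := fun x' => fInv c x' w)
    (Finset.mem_erase.mpr ⟨hxw.symm, Finset.mem_insert_self _ _⟩) (fInv_self c w), mul_zero,
    mul_zero, zero_smul]

/-- `betheVector_insert_left` solved for `T₁₂(w) B(u; v)`, its `T₁₃` terms being Bethe vectors by
`T02_betheVector`. -/
theorem T01_betheVector (hS : M.IsNormalizedOn S) (hc : c ≠ 0) {u v : Finset ℂ} {w : ℂ}
    (hu : ∀ x ∈ u, x ∈ S) (hv : ∀ x ∈ v, x ∈ S) (hw : w ∈ S) (hwu : w ∉ u) (hwv : w ∉ v) :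
    M.T w 0 1 (M.betheVector u v) = ∑ q ∈ insert w v,
      ((h c w q)⁻¹ * fRight c (insert w v) q) •
        M.betheVector (insert w u) ((insert w v).erase q) := by
  rw [Finset.sum_insert hwv, fRight, Finset.erase_insert hwv, h_self_inv c hc, one_mul,
    hS.betheVector_insert_left hc hu hv hw hwu, smul_add, smul_smul,
    hS.prod_f_mul_prod_fInv hv hw hwv, one_smul, add_assoc, left_eq_add, Finset.smul_sum,
    ← Finset.sum_add_distrib]
  refine Finset.sum_eq_zero fun x hx => ?_
  have hxw : x ≠ w := fun e => hwv (e ▸ hx)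
  have hw' : w ∉ v.erase x := fun h' => hwv (Finset.mem_of_mem_erase h')
  have hxS := hv x hx
  rw [fRight, ← insert_erase_comm hwv hx, Finset.prod_insert hw', smul_smul,
    ← hS.T02_betheVector hc hu (fun y hy => hv y (Finset.mem_of_mem_erase hy)) hw hwu hw',
    ← add_smul, ← Finset.mul_prod_erase v _ hx]
  have e1 := hS.prod_f_mul_prod_fInv (fun y hy => hv y (Finset.mem_of_mem_erase hy)) hw hw'
    (X := v.erase x)
  -- `f/h = g` is antisymmetric.
  have e2 : (h c x w)⁻¹ * f c x w + (h c w x)⁻¹ * f c w x = 0 := by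
    rw [← h_mul_g c hc hxw, ← h_mul_g c hc hxw.symm, inv_mul_cancel_left₀ (hS.h_ne_zero hc hxS hw),
      inv_mul_cancel_left₀ (hS.h_ne_zero hc hw hxS), g, g, ← neg_sub x w, div_neg, add_neg_cancel]
  refine smul_eq_zero_of_left ?_ _
  linear_combination ((h c x w)⁻¹ * f c x w * (∏ y ∈ v.erase x, f c y x)) * e1 +
    (∏ y ∈ v.erase x, f c y x) * e2

theorem betheVector_empty (hS : M.IsNormalizedOn S) {v : Finset ℂ} (hv : ∀ x ∈ v, x ∈ S) :
    M.betheVector ∅ v = M.TProd 1 2 v M.vac := by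
  rw [hS.betheVector_eq (by simp) hv, Finset.powerset_empty, Finset.sum_singleton,
    Finset.sum_eq_single ∅]
  · simp [KDivF_empty, fProd, fInvProd, monomial, TProd]
  · intro vI _ hne
    rw [KDivF_of_card_ne, zero_mul, zero_smul]
    simpa [eq_comm] using hne
  · intro h'
    exact absurd (Finset.empty_mem_powerset v) h'

theorem T12_betheVector_empty (hS : M.IsNormalizedOn S) {v : Finset ℂ} {w : ℂ}
    (hv : ∀ x ∈ v, x ∈ S) (hw : w ∈ S) (hwv : w ∉ v) :
    M.T w 1 2 (M.betheVector ∅ v) = M.betheVector ∅ (insert w v) := by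
  rw [hS.betheVector_empty hv,
    hS.betheVector_empty ((Finset.forall_mem_insert _ _ _).mpr ⟨hw, hv⟩),
    hS.TProd_insert 1 2 hw hv hwv, Module.End.mul_apply]

theorem T11_mul_T12 (hS : M.IsNormalizedOn S) {x y : ℂ} (hx : x ∈ S) (hy : y ∈ S) (hxy : x ≠ y) :
    M.T x 1 1 * M.T y 1 2 =
      f c y x • (M.T y 1 2 * M.T x 1 1) + g c x y • (M.T x 1 2 * M.T y 1 1) := by
  have h1 := hS.commutation hy hx hxy.symm 1 2 1 1
  have h2 : g c y x = - g c x y := by rw [g, g, ← neg_sub, div_neg]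
  rw [f]
  rw [h2] at h1 ⊢
  linear_combination (norm := module) -h1

/-- The two-variable identity behind the exchange of two operators. -/
theorem h_inv_exchange_right (hS : M.IsNormalizedOn S) (hc : c ≠ 0) {w y q : ℂ} (hw : w ∈ S)
    (hy : y ∈ S) (hq : q ∈ S) (hwy : w ≠ y) :
    f c y w * ((h c w q)⁻¹ * fInv c y q) + g c w y * ((h c y q)⁻¹ * fInv c w q) =
      (h c w q)⁻¹ := by
  have h1 := sub_ne_zero.mpr hwy
  have h2 := hS.add_ne_zero hw hq
  have h3 := hS.add_ne_zero hy hq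
  rw [f, g, g, h, h, fInv, fInv, ← neg_sub w y, div_neg]
  field_simp
  ring

theorem h_inv_exchange_left (hS : M.IsNormalizedOn S) (hc : c ≠ 0) {w z p : ℂ} (hw : w ∈ S)
    (hz : z ∈ S) (hp : p ∈ S) (hwz : w ≠ z) :
    f c w z * ((h c p w)⁻¹ * fInv c p z) - g c w z * ((h c p z)⁻¹ * fInv c p w) =
      (h c p w)⁻¹ := by
  have h1 := sub_ne_zero.mpr hwz
  have h2 := hS.add_ne_zero hp hw
  have h3 := hS.add_ne_zero hp hz
  rw [f, g, h, h, fInv, fInv]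
  field_simp
  ring

/-- With no first variables the vector is `T₂₃(v)|0⟩`, and `T₂₂(w)` is moved through the factors
`T₂₃` one at a time until it meets `|0⟩`, where `λ₂ = 1`. -/
theorem T11_betheVector_empty (hS : M.IsNormalizedOn S) (hc : c ≠ 0) {v : Finset ℂ} :
    ∀ {w : ℂ}, (∀ x ∈ v, x ∈ S) → w ∈ S → w ∉ v →
    M.T w 1 1 (M.betheVector ∅ v) = ∑ q ∈ insert w v,
      ((h c w q)⁻¹ * fRight c (insert w v) q) • M.betheVector ∅ ((insert w v).erase q) := by
  induction v using Finset.induction_on with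
  | empty =>
    intro w hv hw _
    rw [hS.betheVector_empty hv]
    simp only [insert_empty_eq, Finset.sum_singleton, fRight, Finset.erase_singleton,
      Finset.prod_empty, h_self_inv c hc, mul_one, one_smul, hS.betheVector_empty hv]
    simp [TProd, M.diag_vac w (hS.mem_D w hw), hS.lam_eq_one w hw]
  | insert y v hyv ih =>
    intro w hv hw hwv
    rw [Finset.mem_insert, not_or] at hwv
    have hyS := hv y (Finset.mem_insert_self _ _)
    have hvS : ∀ x ∈ v, x ∈ S := fun x hx => hv x (Finset.mem_insert_of_mem hx)
    have hw' : ∀ x ∈ insert w v, x ∈ S := (Finset.forall_mem_insert _ _ _).mpr ⟨hw, hvS⟩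
    have hy' : ∀ x ∈ insert y v, x ∈ S := (Finset.forall_mem_insert _ _ _).mpr ⟨hyS, hvS⟩
    have nyw : y ∉ insert w v := by rw [Finset.mem_insert, not_or]; exact ⟨Ne.symm hwv.1, hyv⟩
    have nwy : w ∉ insert y v := by rw [Finset.mem_insert, not_or]; exact hwv
    rw [← hS.T12_betheVector_empty hvS hyS hyv, ← Module.End.mul_apply,
      hS.T11_mul_T12 hw hyS hwv.1, LinearMap.add_apply, LinearMap.smul_apply,
      LinearMap.smul_apply, Module.End.mul_apply, Module.End.mul_apply, ih hvS hw hwv.2,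
      ih hvS hyS hyv, map_sum, map_sum]
    simp only [map_smul]
    rw [hS.sum_fRight_smul hw' hyS nyw _ _
        (fun q => M.betheVector ∅ ((insert y (insert w v)).erase q)) (fun q hq => by
          rw [hS.T12_betheVector_empty (fun x hx => hw' x (Finset.mem_of_mem_erase hx)) hyS
            (fun h' => nyw (Finset.mem_of_mem_erase h')),
            insert_erase_comm nyw hq]),
      hS.sum_fRight_smul hy' hw nwy _ _
        (fun q => M.betheVector ∅ ((insert w (insert y v)).erase q)) (fun q hq => by
          rw [hS.T12_betheVector_empty (fun x hx => hy' x (Finset.mem_of_mem_erase hx)) hw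
            (fun h' => nwy (Finset.mem_of_mem_erase h')),
            insert_erase_comm nwy hq]),
      Finset.insert_comm y w v, Finset.smul_sum, Finset.smul_sum, ← Finset.sum_add_distrib]
    refine Finset.sum_congr rfl fun q hq => ?_
    have hqS : q ∈ S := (Finset.forall_mem_insert _ _ _).mpr ⟨hw, hy'⟩ q hq
    rw [smul_smul, smul_smul, ← add_smul]
    congr 1
    linear_combination fRight c (insert w (insert y v)) q *
      hS.h_inv_exchange_right hc hw hyS hqS hwv.1

end HighestWeightRep.IsNormalizedOn

/-! ### Joint induction for `T₂₃` and `T₂₂` -/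

/-- The vectors being symmetric in `a` and `b`, only the symmetric part of the coefficients counts;
doubling the sum exhibits it. -/
theorem sum_pairs_smul_congr {W : Type*} [AddCommGroup W] [Module ℂ W] (s : Finset ℂ)
    (t t' : ℂ → ℂ → ℂ) (X : ℂ → ℂ → W) (hX : ∀ a b, X a b = X b a)
    (ht : ∀ a ∈ s, ∀ b ∈ s, t a b + t b a = t' a b + t' b a) :
    ∑ a ∈ s, ∑ b ∈ s.erase a, t a b • X a b = ∑ a ∈ s, ∑ b ∈ s.erase a, t' a b • X a b := by
  have key : ∀ r : ℂ → ℂ → ℂ, (2 : ℂ) • ∑ a ∈ s, ∑ b ∈ s.erase a, r a b • X a b =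
      ∑ a ∈ s, ∑ b ∈ s.erase a, (r a b + r b a) • X a b := by
    intro r
    have e : ∑ a ∈ s, ∑ b ∈ s.erase a, r a b • X a b =
        ∑ a ∈ s, ∑ b ∈ s.erase a, r b a • X a b := by
      rw [sum_erase_erase_comm]
      exact Finset.sum_congr rfl fun a _ => Finset.sum_congr rfl fun b _ => by rw [hX]
    rw [two_smul]
    nth_rewrite 2 [e]
    simp only [← Finset.sum_add_distrib, ← add_smul]
  refine smul_right_injective W (two_ne_zero : (2 : ℂ) ≠ 0) ?_
  simp only [key]
  exact Finset.sum_congr rfl fun a ha => Finset.sum_congr rfl fun b hb => by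
    rw [ht a ha b (Finset.mem_of_mem_erase hb)]

/-- Isolates the one unknown term of a linear relation whose other terms are known. -/
theorem eq_of_sum_insert_smul_eq {W : Type*} [AddCommGroup W] [Module ℂ W] {s : Finset ℂ} {z : ℂ}
    (hz : z ∉ s) {a : ℂ → ℂ} (ha : a z ≠ 0) {X Y : ℂ → W} (hXY : ∀ q ∈ s, X q = Y q)
    (e : ∑ q ∈ insert z s, a q • X q = ∑ q ∈ insert z s, a q • Y q) : X z = Y z := by
  rw [Finset.sum_insert hz, Finset.sum_insert hz,
    Finset.sum_congr rfl fun q hq => by rw [hXY q hq]] at e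
  exact smul_right_injective W ha (add_right_cancel e)

namespace HighestWeightRep

variable {c : ℂ} {V : Type*} [AddCommGroup V] [Module ℂ V] {M : HighestWeightRep c V} {S : Set ℂ}

/-- The formula for the action of `T₂₃(w)` on the Bethe vectors with first set of variables `u`. -/
def T12Formula (M : HighestWeightRep c V) (S : Set ℂ) (u : Finset ℂ) : Prop :=
  ∀ (v : Finset ℂ) (w : ℂ), (∀ x ∈ v, x ∈ S) → w ∈ S → w ∉ u → w ∉ v →
    M.T w 1 2 (M.betheVector u v) = ∑ p ∈ insert w u, ((h c p w)⁻¹ * fLeft c (insert w u) p) •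
      M.betheVector ((insert w u).erase p) (insert w v)

/-- The formula for the action of `T₂₂(w)` on the Bethe vectors with first set of variables `u`. -/
def T11Formula (M : HighestWeightRep c V) (S : Set ℂ) (u : Finset ℂ) : Prop :=
  ∀ (v : Finset ℂ) (w : ℂ), (∀ x ∈ v, x ∈ S) → w ∈ S → w ∉ u → w ∉ v →
    M.T w 1 1 (M.betheVector u v) = ∑ p ∈ insert w u, ((h c p w)⁻¹ * fLeft c (insert w u) p) •
      ∑ q ∈ insert w v, ((h c w q)⁻¹ * fRight c (insert w v) q) •
        M.betheVector ((insert w u).erase p) ((insert w v).erase q)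

namespace IsNormalizedOn

section products

variable {u v : Finset ℂ} {w z : ℂ}

/-- This and the next three products are written over the full sets `{z, w} ∪ u` and `{z, w} ∪ v`,
so that the versions with `w` and `z` interchanged have the same index sets. -/
theorem T02_T12 (hS : M.IsNormalizedOn S) (hc : c ≠ 0) (hu : ∀ x ∈ u, x ∈ S)
    (hv : ∀ x ∈ v, x ∈ S) (hw : w ∈ S) (hz : z ∈ S) (hwu : w ∉ u) (hwv : w ∉ v)
    (hzu : z ∉ insert w u) (hzv : z ∉ insert w v) (hE : M.T12Formula S u) :
    M.T z 0 2 (M.T w 1 2 (M.betheVector u v)) = ∑ p ∈ insert z (insert w u),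
      ((h c p w)⁻¹ * fInv c p z * fLeft c (insert z (insert w u)) p) •
        M.betheVector ((insert z (insert w u)).erase p) (insert z (insert w v)) := by
  have hu' := (Finset.forall_mem_insert _ _ _).mpr ⟨hw, hu⟩
  have hv' := (Finset.forall_mem_insert _ _ _).mpr ⟨hw, hv⟩
  rw [hE v w hv hw hwu hwv, map_sum]
  simp only [map_smul]
  refine hS.sum_fLeft_smul hu' hz hzu _ _ _ fun p hp => ?_
  rw [hS.T02_betheVector hc (fun x hx => hu' x (Finset.mem_of_mem_erase hx)) hv' hz
    (fun h' => hzu (Finset.mem_of_mem_erase h')) hzv, insert_erase_comm hzu hp]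

theorem T02_T11 (hS : M.IsNormalizedOn S) (hc : c ≠ 0) (hu : ∀ x ∈ u, x ∈ S)
    (hv : ∀ x ∈ v, x ∈ S) (hw : w ∈ S) (hz : z ∈ S) (hwu : w ∉ u) (hwv : w ∉ v)
    (hzu : z ∉ insert w u) (hzv : z ∉ insert w v) (hN : M.T11Formula S u) :
    M.T z 0 2 (M.T w 1 1 (M.betheVector u v)) = ∑ p ∈ insert z (insert w u),
      ((h c p w)⁻¹ * fInv c p z * fLeft c (insert z (insert w u)) p) •
        ∑ q ∈ insert z (insert w v),
          ((h c w q)⁻¹ * fInv c z q * fRight c (insert z (insert w v)) q) •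
            M.betheVector ((insert z (insert w u)).erase p)
              ((insert z (insert w v)).erase q) := by
  have hu' := (Finset.forall_mem_insert _ _ _).mpr ⟨hw, hu⟩
  have hv' := (Finset.forall_mem_insert _ _ _).mpr ⟨hw, hv⟩
  rw [hN v w hv hw hwu hwv, map_sum]
  simp only [map_smul, map_sum]
  refine hS.sum_fLeft_smul hu' hz hzu _ _ _ fun p hp => ?_
  refine hS.sum_fRight_smul hv' hz hzv _ _ _ fun q hq => ?_
  rw [hS.T02_betheVector hc (fun x hx => hu' x (Finset.mem_of_mem_erase hx))
    (fun x hx => hv' x (Finset.mem_of_mem_erase hx)) hz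
    (fun h' => hzu (Finset.mem_of_mem_erase h')) (fun h' => hzv (Finset.mem_of_mem_erase h')),
    insert_erase_comm hzu hp, insert_erase_comm hzv hq]

theorem T01_T12 (hS : M.IsNormalizedOn S) (hc : c ≠ 0) (hu : ∀ x ∈ u, x ∈ S)
    (hv : ∀ x ∈ v, x ∈ S) (hw : w ∈ S) (hz : z ∈ S) (hwu : w ∉ u) (hwv : w ∉ v)
    (hzu : z ∉ insert w u) (hzv : z ∉ insert w v) (hE : M.T12Formula S u) :
    M.T z 0 1 (M.T w 1 2 (M.betheVector u v)) = ∑ p ∈ insert z (insert w u),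
      ((h c p w)⁻¹ * fInv c p z * fLeft c (insert z (insert w u)) p) •
        ∑ q ∈ insert z (insert w v), ((h c z q)⁻¹ * fRight c (insert z (insert w v)) q) •
            M.betheVector ((insert z (insert w u)).erase p)
              ((insert z (insert w v)).erase q) := by
  have hu' := (Finset.forall_mem_insert _ _ _).mpr ⟨hw, hu⟩
  have hv' := (Finset.forall_mem_insert _ _ _).mpr ⟨hw, hv⟩
  rw [hE v w hv hw hwu hwv, map_sum]
  simp only [map_smul]
  refine hS.sum_fLeft_smul hu' hz hzu _ _ _ fun p hp => ?_
  rw [hS.T01_betheVector hc (fun x hx => hu' x (Finset.mem_of_mem_erase hx)) hv' hz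
    (fun h' => hzu (Finset.mem_of_mem_erase h')) hzv, insert_erase_comm hzu hp]

theorem T01_T11 (hS : M.IsNormalizedOn S) (hc : c ≠ 0) (hu : ∀ x ∈ u, x ∈ S)
    (hv : ∀ x ∈ v, x ∈ S) (hw : w ∈ S) (hz : z ∈ S) (hwu : w ∉ u) (hwv : w ∉ v)
    (hzu : z ∉ insert w u) (hzv : z ∉ insert w v) (hN : M.T11Formula S u) :
    M.T z 0 1 (M.T w 1 1 (M.betheVector u v)) = ∑ p ∈ insert z (insert w u),
      ((h c p w)⁻¹ * fInv c p z * fLeft c (insert z (insert w u)) p) •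
        ∑ a ∈ insert z (insert w v),
          ((h c w a)⁻¹ * fInv c z a * fRight c (insert z (insert w v)) a) •
            ∑ b ∈ (insert z (insert w v)).erase a,
              ((h c z b)⁻¹ * fRight c ((insert z (insert w v)).erase a) b) •
                M.betheVector ((insert z (insert w u)).erase p)
                  (((insert z (insert w v)).erase a).erase b) := by
  have hu' := (Finset.forall_mem_insert _ _ _).mpr ⟨hw, hu⟩
  have hv' := (Finset.forall_mem_insert _ _ _).mpr ⟨hw, hv⟩
  rw [hN v w hv hw hwu hwv, map_sum]
  simp only [map_smul, map_sum]
  refine hS.sum_fLeft_smul hu' hz hzu _ _ _ fun p hp => ?_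
  refine hS.sum_fRight_smul hv' hz hzv _ _ _ fun q hq => ?_
  rw [hS.T01_betheVector hc (fun x hx => hu' x (Finset.mem_of_mem_erase hx))
    (fun x hx => hv' x (Finset.mem_of_mem_erase hx)) hz
    (fun h' => hzu (Finset.mem_of_mem_erase h')) (fun h' => hzv (Finset.mem_of_mem_erase h')),
    insert_erase_comm hzu hp, insert_erase_comm hzv hq]

end products

/-- The coefficients of `T₂₂(w)T₁₃(z) = T₁₃(z)T₂₂(w) + g(w,z)(T₁₂(z)T₂₃(w) - T₁₂(w)T₂₃(z))` when `p`
and `q` are removed. -/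
theorem h_inv_exchange_mixed (hS : M.IsNormalizedOn S) (hc : c ≠ 0) {w z p q : ℂ} (hw : w ∈ S)
    (hz : z ∈ S) (hp : p ∈ S) (hq : q ∈ S) (hwz : w ≠ z) :
    (h c p w)⁻¹ * fInv c p z * ((h c w q)⁻¹ * fInv c z q) +
      g c w z * ((h c p w)⁻¹ * fInv c p z * (h c z q)⁻¹ -
        (h c p z)⁻¹ * fInv c p w * (h c w q)⁻¹) = (h c p w)⁻¹ * (h c w q)⁻¹ := by
  have h1 := sub_ne_zero.mpr hwz
  have h2 := hS.add_ne_zero hp hw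
  have h3 := hS.add_ne_zero hp hz
  have h4 := hS.add_ne_zero hw hq
  have h5 := hS.add_ne_zero hz hq
  rw [g, h, h, h, h, fInv, fInv, fInv]
  field_simp
  ring

/-- The same for `T₂₃(w)T₁₂(z) = T₁₂(z)T₂₃(w) + g(w,z)(T₁₃(z)T₂₂(w) - T₁₃(w)T₂₂(z))`. -/
theorem h_inv_exchange_mixed' (hS : M.IsNormalizedOn S) (hc : c ≠ 0) {w z p q : ℂ} (hw : w ∈ S)
    (hz : z ∈ S) (hp : p ∈ S) (hq : q ∈ S) (hwz : w ≠ z) :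
    (h c p w)⁻¹ * fInv c p z * (h c z q)⁻¹ +
      g c w z * ((h c p w)⁻¹ * fInv c p z * ((h c w q)⁻¹ * fInv c z q) -
        (h c p z)⁻¹ * fInv c p w * ((h c z q)⁻¹ * fInv c w q)) =
      (h c p w)⁻¹ * ((h c z q)⁻¹ * fInv c w q) := by
  have h1 := sub_ne_zero.mpr hwz
  have h2 := hS.add_ne_zero hp hw
  have h3 := hS.add_ne_zero hp hz
  have h4 := hS.add_ne_zero hw hq
  have h5 := hS.add_ne_zero hz hq
  rw [g, h, h, h, h, fInv, fInv, fInv, fInv]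
  field_simp
  ring

/-- On coefficients, this is the commutativity of `T₁₂(w)` and `T₁₂(z)`: the weight for removing the
pair `a, b` is symmetric in `w` and `z` once it is summed over the order of removal. -/
theorem h_inv_exchange_symm (hS : M.IsNormalizedOn S) (hc : c ≠ 0) {w z a b : ℂ} (hw : w ∈ S)
    (hz : z ∈ S) (ha : a ∈ S) (hb : b ∈ S) :
    (h c z a)⁻¹ * fInv c w a * ((h c w b)⁻¹ * fInv c a b) +
      (h c z b)⁻¹ * fInv c w b * ((h c w a)⁻¹ * fInv c b a) =
    (h c w a)⁻¹ * fInv c z a * ((h c z b)⁻¹ * fInv c a b) +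
      (h c w b)⁻¹ * fInv c z b * ((h c z a)⁻¹ * fInv c b a) := by
  have h1 := hS.add_ne_zero hw ha
  have h2 := hS.add_ne_zero hw hb
  have h3 := hS.add_ne_zero hz ha
  have h4 := hS.add_ne_zero hz hb
  have h5 := hS.add_ne_zero ha hb
  have h6 := hS.add_ne_zero hb ha
  rw [h, h, h, h, fInv, fInv, fInv, fInv, fInv, fInv]
  field_simp
  ring

/-- The vector is `T₁₃(z) B(u; v)`, and commuting `T₂₃(w)` with `T₁₃(z)` leaves only products of the
same two kinds, known from the formula for `u`. -/
theorem T12_betheVector_insert_insert (hS : M.IsNormalizedOn S) (hc : c ≠ 0) {u v : Finset ℂ}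
    {w z : ℂ} (hu : ∀ x ∈ u, x ∈ S) (hv : ∀ x ∈ v, x ∈ S) (hw : w ∈ S) (hz : z ∈ S)
    (hwu : w ∉ insert z u) (hwv : w ∉ insert z v) (hzu : z ∉ u) (hzv : z ∉ v)
    (hE : M.T12Formula S u) :
    M.T w 1 2 (M.betheVector (insert z u) (insert z v)) = ∑ p ∈ insert w (insert z u),
      ((h c p w)⁻¹ * fLeft c (insert w (insert z u)) p) •
        M.betheVector ((insert w (insert z u)).erase p) (insert w (insert z v)) := by
  have hwu' := Finset.mem_insert.not.mp hwu
  have hwv' := Finset.mem_insert.not.mp hwv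
  rw [not_or] at hwu' hwv'
  have hzu' : z ∉ insert w u := by rw [Finset.mem_insert, not_or]; exact ⟨Ne.symm hwu'.1, hzu⟩
  have hzv' : z ∉ insert w v := by rw [Finset.mem_insert, not_or]; exact ⟨Ne.symm hwu'.1, hzv⟩
  rw [← hS.T02_betheVector hc hu hv hz hzu hzv, ← Module.End.mul_apply,
    hS.commutation hw hz hwu'.1]
  simp only [LinearMap.add_apply, LinearMap.smul_apply, LinearMap.sub_apply, Module.End.mul_apply]
  rw [hS.T02_T12 hc hu hv hw hz hwu'.2 hwv'.2 hzu' hzv' hE,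
    hS.T02_T12 hc hu hv hz hw hzu hzv hwu hwv hE, Finset.insert_comm z w u,
    Finset.insert_comm z w v]
  simp only [Finset.smul_sum, smul_smul, ← Finset.sum_sub_distrib, ← Finset.sum_add_distrib,
    ← sub_smul, ← add_smul]
  refine Finset.sum_congr rfl fun p hp => ?_
  have hpS : p ∈ S := by
    rcases Finset.mem_insert.mp hp with rfl | hp
    · exact hw
    · exact (Finset.forall_mem_insert _ _ _).mpr ⟨hz, hu⟩ p hp
  have e := hS.h_inv_exchange_left hc hw hz hpS hwu'.1
  rw [f] at e
  congr 1
  linear_combination fLeft c (insert w (insert z u)) p * e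

theorem T11_betheVector_insert_insert (hS : M.IsNormalizedOn S) (hc : c ≠ 0) {u v : Finset ℂ}
    {w z : ℂ} (hu : ∀ x ∈ u, x ∈ S) (hv : ∀ x ∈ v, x ∈ S) (hw : w ∈ S) (hz : z ∈ S)
    (hwu : w ∉ insert z u) (hwv : w ∉ insert z v) (hzu : z ∉ u) (hzv : z ∉ v)
    (hE : M.T12Formula S u) (hN : M.T11Formula S u) :
    M.T w 1 1 (M.betheVector (insert z u) (insert z v)) = ∑ p ∈ insert w (insert z u),
      ((h c p w)⁻¹ * fLeft c (insert w (insert z u)) p) • ∑ q ∈ insert w (insert z v),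
        ((h c w q)⁻¹ * fRight c (insert w (insert z v)) q) •
          M.betheVector ((insert w (insert z u)).erase p) ((insert w (insert z v)).erase q) := by
  have hwu' := Finset.mem_insert.not.mp hwu
  have hwv' := Finset.mem_insert.not.mp hwv
  rw [not_or] at hwu' hwv'
  have hzu' : z ∉ insert w u := by rw [Finset.mem_insert, not_or]; exact ⟨Ne.symm hwu'.1, hzu⟩
  have hzv' : z ∉ insert w v := by rw [Finset.mem_insert, not_or]; exact ⟨Ne.symm hwu'.1, hzv⟩
  rw [← hS.T02_betheVector hc hu hv hz hzu hzv, ← Module.End.mul_apply,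
    hS.commutation hw hz hwu'.1]
  simp only [LinearMap.add_apply, LinearMap.smul_apply, LinearMap.sub_apply, Module.End.mul_apply]
  rw [hS.T02_T11 hc hu hv hw hz hwu'.2 hwv'.2 hzu' hzv' hN,
    hS.T01_T12 hc hu hv hw hz hwu'.2 hwv'.2 hzu' hzv' hE,
    hS.T01_T12 hc hu hv hz hw hzu hzv hwu hwv hE, Finset.insert_comm z w u,
    Finset.insert_comm z w v]
  simp only [Finset.smul_sum, smul_smul, ← Finset.sum_sub_distrib, ← Finset.sum_add_distrib,
    ← sub_smul, ← add_smul]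
  refine Finset.sum_congr rfl fun p hp => Finset.sum_congr rfl fun q hq => ?_
  have hpS : p ∈ S := by
    rcases Finset.mem_insert.mp hp with rfl | hp
    · exact hw
    · exact (Finset.forall_mem_insert _ _ _).mpr ⟨hz, hu⟩ p hp
  have hqS : q ∈ S := by
    rcases Finset.mem_insert.mp hq with rfl | hq
    · exact hw
    · exact (Finset.forall_mem_insert _ _ _).mpr ⟨hz, hv⟩ q hq
  have e := hS.h_inv_exchange_mixed hc hw hz hpS hqS hwu'.1
  congr 1
  linear_combination fLeft c (insert w (insert z u)) p * fRight c (insert w (insert z v)) q * e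

theorem h_inv_mul_fRight_self_ne_zero (hS : M.IsNormalizedOn S) (hc : c ≠ 0) {v : Finset ℂ}
    {z : ℂ} (hv : ∀ x ∈ v, x ∈ S) (hz : z ∈ S) (hzv : z ∉ v) :
    (h c z z)⁻¹ * fRight c (insert z v) z ≠ 0 := by
  rw [h_self_inv c hc, one_mul, fRight, Finset.erase_insert hzv]
  exact Finset.prod_ne_zero_iff.mpr fun y hy =>
    hS.f_ne_zero (hv y hy) hz (ne_of_mem_of_not_mem hy hzv)

/-- In `T₁₂(z) B(u; v)` the term `q = z` is a nonzero multiple of the wanted vector, and all others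
have `z` in both sets, where the formula is known. Hence it suffices to find `T₂₃(w) T₁₂(z) B(u;
v)`; the commutator brings in `T₂₂`. -/
theorem T12_betheVector_insert (hS : M.IsNormalizedOn S) (hc : c ≠ 0) {u v : Finset ℂ}
    {w z : ℂ} (hu : ∀ x ∈ u, x ∈ S) (hv : ∀ x ∈ v, x ∈ S) (hw : w ∈ S) (hz : z ∈ S)
    (hwu : w ∉ insert z u) (hwv : w ∉ insert z v) (hzu : z ∉ u) (hzv : z ∉ v)
    (hE : M.T12Formula S u) (hN : M.T11Formula S u) :
    M.T w 1 2 (M.betheVector (insert z u) v) = ∑ p ∈ insert w (insert z u),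
      ((h c p w)⁻¹ * fLeft c (insert w (insert z u)) p) •
        M.betheVector ((insert w (insert z u)).erase p) (insert w v) := by
  have hwu' := Finset.mem_insert.not.mp hwu
  have hwv' := Finset.mem_insert.not.mp hwv
  rw [not_or] at hwu' hwv'
  have hzu' : z ∉ insert w u := by rw [Finset.mem_insert, not_or]; exact ⟨Ne.symm hwu'.1, hzu⟩
  have hzv' : z ∉ insert w v := by rw [Finset.mem_insert, not_or]; exact ⟨Ne.symm hwu'.1, hzv⟩
  have main := eq_of_sum_insert_smul_eq hzv
    (a := fun q => (h c z q)⁻¹ * fRight c (insert z v) q)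
    (hS.h_inv_mul_fRight_self_ne_zero hc hv hz hzv)
    (X := fun q => M.T w 1 2 (M.betheVector (insert z u) ((insert z v).erase q)))
    (Y := fun q => ∑ p ∈ insert w (insert z u),
      ((h c p w)⁻¹ * fLeft c (insert w (insert z u)) p) •
        M.betheVector ((insert w (insert z u)).erase p) (insert w ((insert z v).erase q)))
    ?_ ?_
  · simpa only [Finset.erase_insert hzv] using main
  · intro q hq
    rw [← insert_erase_comm hzv hq]
    refine hS.T12_betheVector_insert_insert hc hu (fun x hx => hv x (Finset.mem_of_mem_erase hx))
      hw hz hwu (fun h' => hwv ?_) hzu (fun h' => hzv (Finset.mem_of_mem_erase h')) hE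
    rw [insert_erase_comm hzv hq] at h'
    exact Finset.mem_of_mem_erase h'
  · have e1 := hS.T01_betheVector hc hu hv hz hzu hzv
    have e2 := congrArg (M.T w 1 2) e1
    rw [map_sum] at e2
    simp only [map_smul] at e2
    rw [← e2, ← Module.End.mul_apply, hS.commutation hw hz hwu'.1]
    simp only [LinearMap.add_apply, LinearMap.smul_apply, LinearMap.sub_apply,
      Module.End.mul_apply]
    rw [hS.T01_T12 hc hu hv hw hz hwu'.2 hwv'.2 hzu' hzv' hE,
      hS.T02_T11 hc hu hv hw hz hwu'.2 hwv'.2 hzu' hzv' hN,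
      hS.T02_T11 hc hu hv hz hw hzu hzv hwu hwv hN,
      hS.sum_fRight_smul ((Finset.forall_mem_insert _ _ _).mpr ⟨hz, hv⟩) hw hwv _ _
        (fun q => ∑ p ∈ insert w (insert z u),
          ((h c p w)⁻¹ * fLeft c (insert w (insert z u)) p) •
          M.betheVector ((insert w (insert z u)).erase p) ((insert w (insert z v)).erase q))
        (fun q hq => by rw [insert_erase_comm hwv hq]),
      Finset.insert_comm z w u, Finset.insert_comm z w v]
    simp only [Finset.smul_sum, smul_smul, ← Finset.sum_sub_distrib, ← Finset.sum_add_distrib,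
      ← sub_smul, ← add_smul]
    rw [Finset.sum_comm]
    refine Finset.sum_congr rfl fun q hq => Finset.sum_congr rfl fun p hp => ?_
    have hpS : p ∈ S := by
      rcases Finset.mem_insert.mp hp with rfl | hp
      · exact hw
      · exact (Finset.forall_mem_insert _ _ _).mpr ⟨hz, hu⟩ p hp
    have hqS : q ∈ S := by
      rcases Finset.mem_insert.mp hq with rfl | hq
      · exact hw
      · exact (Finset.forall_mem_insert _ _ _).mpr ⟨hz, hv⟩ q hq
    have e := hS.h_inv_exchange_mixed' hc hw hz hpS hqS hwu'.1
    congr 1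
    linear_combination fLeft c (insert w (insert z u)) p * fRight c (insert w (insert z v)) q * e

theorem fRight_erase (hS : M.IsNormalizedOn S) {ξ : Finset ℂ} {a b : ℂ} (hξ : ∀ x ∈ ξ, x ∈ S)
    (ha : a ∈ ξ) (hb : b ∈ ξ.erase a) :
    fRight c (ξ.erase a) b = fRight c ξ b * fInv c a b := by
  conv_rhs => rw [← Finset.insert_erase ha]
  exact hS.fRight_eq (fun x hx => hξ x (Finset.mem_of_mem_erase hx)) (hξ a ha) hb
    (Finset.notMem_erase a ξ)

theorem T11_betheVector_insert (hS : M.IsNormalizedOn S) (hc : c ≠ 0) {u v : Finset ℂ}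
    {w z : ℂ} (hu : ∀ x ∈ u, x ∈ S) (hv : ∀ x ∈ v, x ∈ S) (hw : w ∈ S) (hz : z ∈ S)
    (hwu : w ∉ insert z u) (hwv : w ∉ insert z v) (hzu : z ∉ u) (hzv : z ∉ v)
    (hE : M.T12Formula S u) (hN : M.T11Formula S u) :
    M.T w 1 1 (M.betheVector (insert z u) v) = ∑ p ∈ insert w (insert z u),
      ((h c p w)⁻¹ * fLeft c (insert w (insert z u)) p) • ∑ q ∈ insert w v,
        ((h c w q)⁻¹ * fRight c (insert w v) q) •
          M.betheVector ((insert w (insert z u)).erase p) ((insert w v).erase q) := by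
  have hwu' := Finset.mem_insert.not.mp hwu
  have hwv' := Finset.mem_insert.not.mp hwv
  rw [not_or] at hwu' hwv'
  have hzu' : z ∉ insert w u := by rw [Finset.mem_insert, not_or]; exact ⟨Ne.symm hwu'.1, hzu⟩
  have hzv' : z ∉ insert w v := by rw [Finset.mem_insert, not_or]; exact ⟨Ne.symm hwu'.1, hzv⟩
  have main := eq_of_sum_insert_smul_eq hzv
    (a := fun q => (h c z q)⁻¹ * fRight c (insert z v) q)
    (hS.h_inv_mul_fRight_self_ne_zero hc hv hz hzv)
    (X := fun q => M.T w 1 1 (M.betheVector (insert z u) ((insert z v).erase q)))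
    (Y := fun a => ∑ p ∈ insert w (insert z u),
      ((h c p w)⁻¹ * fLeft c (insert w (insert z u)) p) •
        ∑ q ∈ insert w ((insert z v).erase a),
        ((h c w q)⁻¹ * fRight c (insert w ((insert z v).erase a)) q) •
          M.betheVector ((insert w (insert z u)).erase p)
            ((insert w ((insert z v).erase a)).erase q))
    ?_ ?_
  · simpa only [Finset.erase_insert hzv] using main
  · intro q hq
    rw [← insert_erase_comm hzv hq]
    refine hS.T11_betheVector_insert_insert hc hu (fun x hx => hv x (Finset.mem_of_mem_erase hx))
      hw hz hwu (fun h' => hwv ?_) hzu (fun h' => hzv (Finset.mem_of_mem_erase h')) hE hN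
    rw [insert_erase_comm hzv hq] at h'
    exact Finset.mem_of_mem_erase h'
  · have e1 := hS.T01_betheVector hc hu hv hz hzu hzv
    have e2 := congrArg (M.T w 1 1) e1
    rw [map_sum] at e2
    simp only [map_smul] at e2
    rw [← e2, ← Module.End.mul_apply, hS.commutation hw hz hwu'.1]
    simp only [LinearMap.add_apply, LinearMap.smul_apply, LinearMap.sub_apply,
      Module.End.mul_apply]
    rw [hS.T01_T11 hc hu hv hw hz hwu'.2 hwv'.2 hzu' hzv' hN,
      hS.T01_T11 hc hu hv hz hw hzu hzv hwu hwv hN,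
      hS.sum_fRight_smul ((Finset.forall_mem_insert _ _ _).mpr ⟨hz, hv⟩) hw hwv _ _
        (fun a => ∑ p ∈ insert w (insert z u),
          ((h c p w)⁻¹ * fLeft c (insert w (insert z u)) p) •
          ∑ q ∈ (insert w (insert z v)).erase a,
            ((h c w q)⁻¹ * fRight c ((insert w (insert z v)).erase a) q) •
            M.betheVector ((insert w (insert z u)).erase p)
              (((insert w (insert z v)).erase a).erase q))
        (fun q hq => by rw [insert_erase_comm hwv hq]),
      Finset.insert_comm z w u, Finset.insert_comm z w v]
    simp only [Finset.smul_sum, smul_smul, ← Finset.sum_sub_distrib, ← Finset.sum_add_distrib,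
      ← sub_smul, ← add_smul]
    rw [Finset.sum_comm (t := insert w (insert z u))]
    refine Finset.sum_congr rfl fun p hp => ?_
    have hpS : p ∈ S := by
      rcases Finset.mem_insert.mp hp with rfl | hp
      · exact hw
      · exact (Finset.forall_mem_insert _ _ _).mpr ⟨hz, hu⟩ p hp
    have hξS : ∀ q ∈ insert w (insert z v), q ∈ S := by
      intro q hq
      rcases Finset.mem_insert.mp hq with rfl | hq
      · exact hw
      · exact (Finset.forall_mem_insert _ _ _).mpr ⟨hz, hv⟩ q hq
    set ξ := insert w (insert z v)
    have e3 : ∀ a ∈ ξ, ∀ b ∈ ξ.erase a, fRight c (ξ.erase a) b = fRight c ξ b * fInv c a b :=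
      fun a ha b hb => hS.fRight_erase hξS ha hb
    rw [Finset.sum_congr rfl fun a ha => Finset.sum_congr rfl fun b hb => by rw [e3 a ha b hb]]
    conv_rhs =>
      rw [Finset.sum_congr rfl fun a ha => Finset.sum_congr rfl fun b hb => by rw [e3 a ha b hb]]
    -- Two elements leave the second set, and their order does not affect the vector, so the
    -- coefficients need to agree only after symmetrization.
    refine sum_pairs_smul_congr ξ _ _
      (fun a b => M.betheVector ((insert w (insert z u)).erase p) ((ξ.erase a).erase b))
      (fun a b => by rw [Finset.erase_right_comm]) fun a ha b hb => ?_
    have e4 := hS.h_inv_exchange_left hc hw hz hpS hwu'.1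
    have e5 := hS.h_inv_exchange_symm hc hw hz (hξS a ha) (hξS b hb)
    rw [f] at e4
    linear_combination fLeft c (insert w (insert z u)) p * fRight c ξ a * fRight c ξ b *
      (((h c z a)⁻¹ * fInv c w a * ((h c w b)⁻¹ * fInv c a b) +
        (h c z b)⁻¹ * fInv c w b * ((h c w a)⁻¹ * fInv c b a)) * e4 -
      (1 + g c w z) * ((h c p w)⁻¹ * fInv c p z) * e5)

/-- Neither formula can be proved alone: the step for `T₂₃` uses `T₂₂` at the smaller `u`, and the
step for `T₂₂` uses `T₂₃` there. The new element `z` of the first set may or may not lie in `v`,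
which decides between the two kinds of step. -/
theorem T12Formula_and_T11Formula (hS : M.IsNormalizedOn S) (hc : c ≠ 0) {u : Finset ℂ} :
    (∀ x ∈ u, x ∈ S) → M.T12Formula S u ∧ M.T11Formula S u := by
  induction u using Finset.induction_on with
  | empty =>
    refine fun _ => ⟨fun v w hv hw _ hwv => ?_, fun v w hv hw _ hwv => ?_⟩
    · rw [hS.T12_betheVector_empty hv hw hwv]
      simp [fLeft, h_self_inv c hc]
    · rw [hS.T11_betheVector_empty hc hv hw hwv]
      simp [fLeft, h_self_inv c hc]
  | insert z u hzu ih =>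
    intro hzuS
    obtain ⟨hz, hu⟩ := (Finset.forall_mem_insert _ _ _).mp hzuS
    obtain ⟨hE, hN⟩ := ih hu
    constructor
    · intro v w hv hw hwu hwv
      by_cases hzv : z ∈ v
      · have hv' : ∀ x ∈ v.erase z, x ∈ S := fun x hx => hv x (Finset.mem_of_mem_erase hx)
        rw [← Finset.insert_erase hzv] at hwv ⊢
        exact hS.T12_betheVector_insert_insert hc hu hv' hw hz hwu hwv hzu
          (Finset.notMem_erase z v) hE
      · refine hS.T12_betheVector_insert hc hu hv hw hz hwu ?_ hzu hzv hE hN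
        rw [Finset.mem_insert, not_or]
        exact ⟨fun e => hwu (e ▸ Finset.mem_insert_self _ _), hwv⟩
    · intro v w hv hw hwu hwv
      by_cases hzv : z ∈ v
      · have hv' : ∀ x ∈ v.erase z, x ∈ S := fun x hx => hv x (Finset.mem_of_mem_erase hx)
        rw [← Finset.insert_erase hzv] at hwv ⊢
        exact hS.T11_betheVector_insert_insert hc hu hv' hw hz hwu hwv hzu
          (Finset.notMem_erase z v) hE hN
      · refine hS.T11_betheVector_insert hc hu hv hw hz hwu ?_ hzu hzv hE hN
        rw [Finset.mem_insert, not_or]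
        exact ⟨fun e => hwu (e ▸ Finset.mem_insert_self _ _), hwv⟩

end IsNormalizedOn

end HighestWeightRep

theorem mul_fProd_erase (c : ℂ) (Z : Finset ℂ) {J : Finset ℂ} {x : ℂ} (hx : x ∈ J) :
    (∏ z ∈ Z, f c x z) * fProd c (J.erase x) Z = fProd c J Z := by
  rw [← fProd_insert_left c Z (Finset.notMem_erase x J), Finset.insert_erase hx]

namespace HighestWeightRep

variable {c : ℂ} {V : Type*} [AddCommGroup V] [Module ℂ V] {M : HighestWeightRep c V} {S : Set ℂ}

/-! ### Actions of products of operators on Bethe vectors -/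

namespace IsNormalizedOn

theorem TProd02_betheVector (hS : M.IsNormalizedOn S) (hc : c ≠ 0) {u v w : Finset ℂ}
    (hu : ∀ x ∈ u, x ∈ S) (hv : ∀ x ∈ v, x ∈ S) :
    (∀ x ∈ w, x ∈ S) → Disjoint u w → Disjoint v w →
    M.TProd 0 2 w (M.betheVector u v) = M.betheVector (u ∪ w) (v ∪ w) := by
  induction w using Finset.induction_on with
  | empty => simp [TProd]
  | insert x w hxw ih =>
    intro hw huw hvw
    obtain ⟨hx, hw⟩ := (Finset.forall_mem_insert _ _ _).mp hw
    rw [Finset.disjoint_insert_right] at huw hvw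
    rw [hS.TProd_insert 0 2 hx hw hxw, Module.End.mul_apply, ih hw huw.2 hvw.2,
      hS.T02_betheVector hc (fun y hy => (Finset.mem_union.mp hy).elim (hu y) (hw y))
        (fun y hy => (Finset.mem_union.mp hy).elim (hv y) (hw y)) hx
        (by simp [huw.1, hxw]) (by simp [hvw.1, hxw]), Finset.union_insert, Finset.union_insert]

/-- A further `T₁₂(x)` removes one more element `q`. The marked pairs `(I, q)` are regrouped by `J =
I ∪ {q}`, and the sum over `q ∈ J` is the second recursion for `KDivF`, whose products involve just
`x` and `J`. -/
theorem TProd01_betheVector (hS : M.IsNormalizedOn S) (hc : c ≠ 0) {u v w : Finset ℂ}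
    (hu : ∀ x ∈ u, x ∈ S) (hv : ∀ x ∈ v, x ∈ S) :
    (∀ x ∈ w, x ∈ S) → Disjoint u w → Disjoint v w →
    M.TProd 0 1 w (M.betheVector u v) = ∑ I ∈ (v ∪ w).powersetCard w.card,
      (fProd c ((v ∪ w) \ I) I * KDivF c w I) • M.betheVector (u ∪ w) ((v ∪ w) \ I) := by
  induction w using Finset.induction_on with
  | empty => simp [TProd, fProd, KDivF_empty]
  | insert x w hxw ih =>
    intro hw huw hvw
    obtain ⟨hx, hw⟩ := (Finset.forall_mem_insert _ _ _).mp hw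
    rw [Finset.disjoint_insert_right] at huw hvw
    have huwS : ∀ y ∈ u ∪ w, y ∈ S := fun y hy => (Finset.mem_union.mp hy).elim (hu y) (hw y)
    have hvwS : ∀ y ∈ v ∪ w, y ∈ S := fun y hy => (Finset.mem_union.mp hy).elim (hv y) (hw y)
    have hxu : x ∉ u ∪ w := by simp [huw.1, hxw]
    have hxv : x ∉ v ∪ w := by simp [hvw.1, hxw]
    rw [hS.TProd_insert 0 1 hx hw hxw, Module.End.mul_apply, ih hw huw.2 hvw.2, map_sum,
      Finset.union_insert, Finset.union_insert, Finset.card_insert_of_notMem hxw]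
    set η := u ∪ w
    set ξ := v ∪ w
    have hξS := (Finset.forall_mem_insert _ _ _).mpr ⟨hx, hvwS⟩
    -- The factor `1/f(x,I)` compensates for `x` joining the complement of `I`. It vanishes when `x
    -- ∈ I`, which allows summing over all subsets of `ξ ∪ {x}`.
    let G : ℂ → Finset ℂ → V := fun q I =>
      (fProd c (insert x ξ \ I) I * (∏ i ∈ I, fInv c x i) * KDivF c w I *
        ((h c x q)⁻¹ * fRight c (insert x ξ \ I) q)) •
          M.betheVector (insert x η) ((insert x ξ \ I).erase q)
    have e1 : ∀ I ∈ ξ.powersetCard w.card,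
        M.T x 0 1 ((fProd c (ξ \ I) I * KDivF c w I) • M.betheVector η (ξ \ I)) =
        ∑ q ∈ insert x ξ \ I, G q I := by
      intro I hI
      have hI' := (Finset.mem_powersetCard.mp hI).1
      have hxI : x ∉ I := fun h' => hxv (hI' h')
      rw [map_smul, hS.T01_betheVector hc huwS (fun y hy => hvwS y (Finset.sdiff_subset hy)) hx hxu
        (fun h' => hxv (Finset.sdiff_subset h')), Finset.smul_sum,
        ← Finset.insert_sdiff_of_notMem _ hxI]
      refine Finset.sum_congr rfl fun q _ => ?_
      have e : (∏ i ∈ I, f c x i) * ∏ i ∈ I, fInv c x i = 1 := by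
        rw [← Finset.prod_mul_distrib]
        exact Finset.prod_eq_one fun i hi =>
          hS.f_mul_fInv hx (hvwS i (hI' hi)) fun e => hxI (e ▸ hi)
      simp only [G]
      rw [smul_smul]
      congr 1
      conv_rhs => rw [Finset.insert_sdiff_of_notMem ξ hxI]
      rw [fProd_insert_left c _ fun h' => hxv (Finset.sdiff_subset h'),
        Finset.insert_sdiff_of_notMem ξ hxI]
      linear_combination (-fProd c (ξ \ I) I * KDivF c w I *
        ((h c x q)⁻¹ * fRight c (insert x (ξ \ I)) q)) * e
    have e2 : ∀ I ∈ (insert x ξ).powersetCard w.card, I ∉ ξ.powersetCard w.card →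
        ∑ q ∈ insert x ξ \ I, G q I = 0 := by
      intro I hI hI'
      rw [Finset.mem_powersetCard] at hI hI'
      have hxI : x ∈ I := by
        by_contra hxI
        exact hI' ⟨(Finset.subset_insert_iff_of_notMem hxI).mp hI.1, hI.2⟩
      refine Finset.sum_eq_zero fun q _ => ?_
      simp only [G]
      rw [Finset.prod_eq_zero hxI (fInv_self c x), mul_zero, zero_mul, zero_mul, zero_smul]
    rw [Finset.sum_congr rfl e1, Finset.sum_subset
      (Finset.powersetCard_mono (Finset.subset_insert x ξ)) e2, sum_powersetCard_sdiff]
    refine Finset.sum_congr rfl fun J hJ => ?_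
    have hJ' := (Finset.mem_powersetCard.mp hJ).1
    rw [KDivF_insert_left' c hc hxw (fun y hy => hS.h_ne_zero hc hx (hξS y (hJ' hy)))
      (fun a ha y hy => hS.h_ne_zero hc (hw a ha) (hξS y (hJ' hy))), Finset.mul_sum,
      Finset.sum_smul]
    refine Finset.sum_congr rfl fun q hq => ?_
    have hqJ : q ∉ insert x ξ \ J := fun h' => (Finset.mem_sdiff.mp h').2 hq
    simp only [G]
    rw [sdiff_erase_eq_insert (hJ' hq), Finset.erase_insert hqJ, fRight, Finset.erase_insert hqJ,
      fProd_insert_left c _ hqJ, ← fProd_erase_mul c (insert x ξ \ J) hq]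
    congr 1
    ring

theorem TProd12_betheVector (hS : M.IsNormalizedOn S) (hc : c ≠ 0) {u v w : Finset ℂ}
    (hu : ∀ x ∈ u, x ∈ S) (hv : ∀ x ∈ v, x ∈ S) :
    (∀ x ∈ w, x ∈ S) → Disjoint u w → Disjoint v w →
    M.TProd 1 2 w (M.betheVector u v) = ∑ I ∈ (u ∪ w).powersetCard w.card,
      (fProd c I ((u ∪ w) \ I) * KDivF c I w) • M.betheVector ((u ∪ w) \ I) (v ∪ w) := by
  induction w using Finset.induction_on with
  | empty => simp [TProd, fProd, KDivF_empty]
  | insert x w hxw ih =>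
    intro hw huw hvw
    obtain ⟨hx, hw⟩ := (Finset.forall_mem_insert _ _ _).mp hw
    rw [Finset.disjoint_insert_right] at huw hvw
    have huwS : ∀ y ∈ u ∪ w, y ∈ S := fun y hy => (Finset.mem_union.mp hy).elim (hu y) (hw y)
    have hvwS : ∀ y ∈ v ∪ w, y ∈ S := fun y hy => (Finset.mem_union.mp hy).elim (hv y) (hw y)
    have hxu : x ∉ u ∪ w := by simp [huw.1, hxw]
    have hxv : x ∉ v ∪ w := by simp [hvw.1, hxw]
    rw [hS.TProd_insert 1 2 hx hw hxw, Module.End.mul_apply, ih hw huw.2 hvw.2, map_sum,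
      Finset.union_insert, Finset.union_insert, Finset.card_insert_of_notMem hxw]
    set η := u ∪ w
    set ξ := v ∪ w
    have hηS := (Finset.forall_mem_insert _ _ _).mpr ⟨hx, huwS⟩
    -- Here the compensating factor is `1/f(I,x)`, which again vanishes when `x ∈ I`.
    let G : ℂ → Finset ℂ → V := fun p I =>
      (fProd c I (insert x η \ I) * (∏ i ∈ I, fInv c i x) * KDivF c I w *
        ((h c p x)⁻¹ * fLeft c (insert x η \ I) p)) •
          M.betheVector ((insert x η \ I).erase p) (insert x ξ)
    have e1 : ∀ I ∈ η.powersetCard w.card,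
        M.T x 1 2 ((fProd c I (η \ I) * KDivF c I w) • M.betheVector (η \ I) ξ) =
        ∑ p ∈ insert x η \ I, G p I := by
      intro I hI
      have hI' := (Finset.mem_powersetCard.mp hI).1
      have hxI : x ∉ I := fun h' => hxu (hI' h')
      have hηI : ∀ y ∈ η \ I, y ∈ S := fun y hy => huwS y (Finset.sdiff_subset hy)
      rw [map_smul, (hS.T12Formula_and_T11Formula hc hηI).1 ξ x hvwS hx
        (fun h' => hxu (Finset.sdiff_subset h')) hxv, Finset.smul_sum,
        ← Finset.insert_sdiff_of_notMem _ hxI]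
      refine Finset.sum_congr rfl fun p _ => ?_
      have e := hS.prod_f_mul_prod_fInv (fun i hi => huwS i (hI' hi)) hx hxI
      simp only [G]
      rw [smul_smul]
      congr 1
      rw [Finset.insert_sdiff_of_notMem η hxI,
        fProd_insert_right c _ fun h' => hxu (Finset.sdiff_subset h')]
      linear_combination (-fProd c I (η \ I) * KDivF c I w *
        ((h c p x)⁻¹ * fLeft c (insert x (η \ I)) p)) * e
    have e2 : ∀ I ∈ (insert x η).powersetCard w.card, I ∉ η.powersetCard w.card →
        ∑ p ∈ insert x η \ I, G p I = 0 := by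
      intro I hI hI'
      rw [Finset.mem_powersetCard] at hI hI'
      have hxI : x ∈ I := by
        by_contra hxI
        exact hI' ⟨(Finset.subset_insert_iff_of_notMem hxI).mp hI.1, hI.2⟩
      refine Finset.sum_eq_zero fun p _ => ?_
      simp only [G]
      rw [Finset.prod_eq_zero (f := fun i => fInv c i x) hxI (fInv_self c x), mul_zero, zero_mul, zero_mul, zero_smul]
    rw [Finset.sum_congr rfl e1, Finset.sum_subset
      (Finset.powersetCard_mono (Finset.subset_insert x η)) e2, sum_powersetCard_sdiff]
    refine Finset.sum_congr rfl fun J hJ => ?_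
    have hJ' := (Finset.mem_powersetCard.mp hJ).1
    rw [KDivF_insert_right' c hc hxw (fun y hy => hS.h_ne_zero hc (hηS y (hJ' hy)) hx)
      (fun y hy a ha => hS.h_ne_zero hc (hηS y (hJ' hy)) (hw a ha)), Finset.mul_sum,
      Finset.sum_smul]
    refine Finset.sum_congr rfl fun p hp => ?_
    have hpJ : p ∉ insert x η \ J := fun h' => (Finset.mem_sdiff.mp h').2 hp
    simp only [G]
    rw [sdiff_erase_eq_insert (hJ' hp), Finset.erase_insert hpJ, fLeft, Finset.erase_insert hpJ,
      fProd_insert_right c _ hpJ, ← mul_fProd_erase c (insert x η \ J) hp]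
    congr 1
    ring

end IsNormalizedOn

/-! ### Normalization of `λ₂` -/

/-- The representation with the monodromy matrix `λ₂(x)⁻¹ T(x)`, where `λ₂(x) ≠ 0`. -/
def normalize (M : HighestWeightRep c V) : HighestWeightRep c V where
  D := {x | x ∈ M.D ∧ M.lam 1 x ≠ 0}
  T x := (M.lam 1 x)⁻¹ • M.T x
  rtt x hx y hy hxy hf := by
    have := M.rtt x hx.1 y hy.1 hxy hf
    simp only [Matrix.smul_kronecker, Matrix.kronecker_smul, Matrix.smul_mul, Matrix.mul_smul,
      this]
    rw [smul_comm]
  vac := M.vac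
  vac_ne_zero := M.vac_ne_zero
  lam i x := (M.lam 1 x)⁻¹ * M.lam i x
  lower_vac x hx i j hij := by simp [M.lower_vac x hx.1 i j hij]
  diag_vac x hx i := by simp [M.diag_vac x hx.1 i, smul_smul]

theorem normalize_TProd (M : HighestWeightRep c V) (i j : Fin 3) (X : Finset ℂ) :
    M.normalize.TProd i j X = (M.lam2 X)⁻¹ • M.TProd i j X := by
  unfold TProd lam2
  rw [← Finset.prod_map_toList]
  induction X.toList with
  | nil => simp
  | cons x l ih =>
    simp only [List.map_cons, List.prod_cons, ih]
    rw [show M.normalize.T x i j = (M.lam 1 x)⁻¹ • M.T x i j from rfl, smul_mul_smul_comm,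
      mul_inv]

theorem TProd_eq_smul_normalize (M : HighestWeightRep c V) (i j : Fin 3) {X : Finset ℂ}
    (hX : ∀ x ∈ X, M.lam 1 x ≠ 0) : M.TProd i j X = M.lam2 X • M.normalize.TProd i j X := by
  have h0 : M.lam2 X ≠ 0 := Finset.prod_ne_zero_iff.mpr hX
  rw [normalize_TProd, smul_smul, mul_inv_cancel₀ h0, one_smul]

theorem normalize_lam2 (M : HighestWeightRep c V) {X : Finset ℂ}
    (hX : ∀ x ∈ X, M.lam 1 x ≠ 0) : M.normalize.lam2 X = 1 :=
  Finset.prod_eq_one fun x hx => inv_mul_cancel₀ (hX x hx)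

/-- Each term contains the operators at `u_II`, `u_I` and `v_II`, so rescaling produces exactly the
denominator `λ₂(u) λ₂(v_II)`. -/
theorem betheVector_normalize (M : HighestWeightRep c V) {u v : Finset ℂ}
    (hu : ∀ x ∈ u, M.lam 1 x ≠ 0) (hv : ∀ x ∈ v, M.lam 1 x ≠ 0) :
    M.normalize.betheVector u v = M.betheVector u v := by
  unfold betheVector
  refine Finset.sum_congr rfl fun uI huI => Finset.sum_congr rfl fun vI _ => ?_
  have e : M.lam2 u = M.lam2 (u \ uI) * M.lam2 uI :=
    (Finset.prod_sdiff (Finset.mem_powerset.mp huI)).symm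
  rw [M.normalize_lam2 hu, M.normalize_lam2 fun x hx => hv x (Finset.sdiff_subset hx),
    normalize_TProd, normalize_TProd, normalize_TProd, smul_mul_smul_comm, smul_mul_smul_comm,
    LinearMap.smul_apply, smul_smul, e]
  congr 1
  rw [mul_one, div_one, div_eq_mul_inv, mul_inv, mul_inv]
  ring

end HighestWeightRep

end GL3

end

/-! ### The multiple action formulas -/

theorem mainTheorem1 (c : ℂ) (hc : c ≠ 0) {V : Type*} [AddCommGroup V] [Module ℂ V]
    (M : GL3.HighestWeightRep c V) (u v w : Finset ℂ)
    (hD : ∀ x ∈ u ∪ v ∪ w, x ∈ M.D) (hlam : ∀ x ∈ u ∪ v ∪ w, M.lam 1 x ≠ 0)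
    (huv : Disjoint u v) (huw : Disjoint u w) (hvw : Disjoint v w)
    (hgen : ∀ x ∈ u ∪ v ∪ w, ∀ y ∈ u ∪ v ∪ w, x - y ≠ c) :
    M.TProd 0 2 w (M.betheVector u v) = M.lam2 w • M.betheVector (u ∪ w) (v ∪ w) ∧
    M.TProd 0 1 w (M.betheVector u v) =
      ((-1) ^ w.card * M.lam2 w) •
        ∑ ξI ∈ (v ∪ w).powersetCard w.card,
          (GL3.fProd c ((v ∪ w) \ ξI) ξI * GL3.K c ξI (GL3.shift c w)) •
            M.betheVector (u ∪ w) ((v ∪ w) \ ξI) ∧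
    M.TProd 1 2 w (M.betheVector u v) =
      ((-1) ^ w.card * M.lam2 w) •
        ∑ ηI ∈ (u ∪ w).powersetCard w.card,
          (GL3.fProd c ηI ((u ∪ w) \ ηI) * GL3.K c w (GL3.shift c ηI)) •
            M.betheVector ((u ∪ w) \ ηI) (v ∪ w) := by
  have hS : M.normalize.IsNormalizedOn (u ∪ v ∪ w : Finset ℂ) :=
    ⟨fun x hx => ⟨hD x hx, hlam x hx⟩, fun x hx => inv_mul_cancel₀ (hlam x hx), hgen⟩
  have hu : ∀ x ∈ u, x ∈ u ∪ v ∪ w := fun x hx => by simp [hx]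
  have hv : ∀ x ∈ v, x ∈ u ∪ v ∪ w := fun x hx => by simp [hx]
  have hw : ∀ x ∈ w, x ∈ u ∪ v ∪ w := fun x hx => by simp [hx]
  have huw' : ∀ x ∈ u ∪ w, M.lam 1 x ≠ 0 :=
    fun x hx => hlam x ((Finset.mem_union.mp hx).elim (hu x) (hw x))
  have hvw' : ∀ x ∈ v ∪ w, M.lam 1 x ≠ 0 :=
    fun x hx => hlam x ((Finset.mem_union.mp hx).elim (hv x) (hw x))
  have hT := fun i j => M.TProd_eq_smul_normalize i j fun x hx => hlam x (hw x hx)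
  -- The sign in the statement cancels the one produced by `K_shift`.
  have hsign : ((-1 : ℂ) ^ w.card) * (-1) ^ w.card = 1 := by rw [← mul_pow]; simp
  rw [← M.betheVector_normalize (fun x hx => hlam x (hu x hx)) (fun x hx => hlam x (hv x hx)),
    ← M.betheVector_normalize huw' hvw', hT, hT, hT, LinearMap.smul_apply, LinearMap.smul_apply,
    LinearMap.smul_apply, hS.TProd02_betheVector hc hu hv hw huw hvw,
    hS.TProd01_betheVector hc hu hv hw huw hvw, hS.TProd12_betheVector hc hu hv hw huw hvw]
  refine ⟨rfl, ?_, ?_⟩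
  · rw [mul_comm (_ ^ _), mul_smul]
    congr 1
    rw [Finset.smul_sum]
    refine Finset.sum_congr rfl fun I hI => ?_
    rw [GL3.K_shift c (Finset.mem_powersetCard.mp hI).2.symm, (Finset.mem_powersetCard.mp hI).2,
      M.betheVector_normalize huw' fun x hx => hvw' x (Finset.sdiff_subset hx), smul_smul]
    congr 1
    linear_combination (-GL3.fProd c ((v ∪ w) \ I) I * GL3.KDivF c w I) * hsign
  · rw [mul_comm (_ ^ _), mul_smul]
    congr 1
    rw [Finset.smul_sum]
    refine Finset.sum_congr rfl fun I hI => ?_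
    rw [GL3.K_shift c (Finset.mem_powersetCard.mp hI).2,
      M.betheVector_normalize (fun x hx => huw' x (Finset.sdiff_subset hx)) hvw', smul_smul]
    congr 1
    linear_combination (-GL3.fProd c I ((u ∪ w) \ I) * GL3.KDivF c I w) * hsign
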